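/- Let $\Lambda$ be a $\sigma$-compact, locally compact metric space with its Borel $\sigma$-algebra. Let $\Gamma_\Lambda$ be the space of configurations, i.e. of subsets $\omega\subset\Lambda$ such that $\omega\cap K$ is finite for every compact $K$; identify $\omega$ with the measure $\sum_{x\in\omega}\varepsilon_x$. Let $\mathfrak M(\Lambda)$ be the space of positive diffuse Radon measures on $\Lambda$. Both spaces carry the vague topology (the coarsest one for which $\omega\mapsto\int f\,d\omega$, respectively $m\mapsto\int f\,dm$, is continuous for every continuous compactly supported $f:\Lambda\to\mathbb R$) and its Borel $\sigma$-algebra. For $m\in\mathfrak M(\Lambda)$ let $\mu_m$ be the Poisson measure of intensity $m$, i.e. the probability measure on $\Gamma_\Lambda$ characterized by $$\int_{\Gamma_\Lambda}\exp\Big(\int_\Lambda f\,d\omega\Big)\,d\mu_m(\omega)=\exp\Big(\int_\Lambda(e^f-1)\,dm\Big)$$ for all continuous compactly supported $f$. Let $\rho_1(\omega,\eta)=\sum_{x\in\Lambda}|\omega(\{x\})-\eta(\{x\})|\in[0,\infty]$ be the number of points that belong to exactly one of $\omega,\eta\in\Gamma_\Lambda$. Let $\sigma\in\mathfrak M(\Lambda)$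 and let $P_M$ be a probability measure on $\mathfrak M(\Lambda)$, the law of a random intensity $M$. On $\Gamma_\Lambda\times\mathfrak M(\Lambda)$ consider the probability measures $$d\mu'_\sigma(\omega,m)=d\mu_\sigma(\omega)\,dP_M(m),\qquad d\mu'_M(\omega,m)=d\mu_m(\omega)\,dP_M(m)$$ (with $M(\omega,m)=m$; under $\mu'_M$ the configuration is a Cox process with random intensity $M$), and let $$\mathcal T_{\rho_1}(\mu'_\sigma,\mu'_M)=\inf_\gamma\int\rho_1(\omega,\omega')\,d\gamma\big((\omega,m),(\omega',m')\big),$$ where $\gamma$ runs over the probability measures on $(\Gamma_\Lambda\times\mathfrak M(\Lambda))^2$ with marginals $\mu'_\sigma$ and $\mu'_M$. Assume that, $\mu'_\sigma$-a.s., $M$ is absolutely continuous with respect to $\sigma$, and that there is a measurable version of the density, i.e. a jointly measurable function $(m,x)\mapsto\frac{dm}{d\sigma}(x)$ on $\mathfrak M(\Lambda)\times\Lambda$ which for $P_M$-a.e. $m$ is a density of $m$ with respect to $\sigma$, such that $\frac{dM}{d\sigma}-1\in L^1(\mu'_\sigma\otimes\sigma)$. Then $$\mathcal T_{\rho_1}(\mu'_\sigma,\mu'_M)\le\mathbb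 E_{\mu'_\sigma}\Big[\int_\Lambda\Big|\frac{dM}{d\sigma}(x)-1\Big|\,d\sigma(x)\Big].$$ -/

import Mathlib

open MeasureTheory
open scoped ENNReal CompactlySupported

noncomputable section

/-- The configuration space over `Λ`: subsets of `Λ` that meet every compact set in a
finite set. -/
@[ext]
structure ConfigSpace (Λ : Type*) [TopologicalSpace Λ] where
  carrier : Set Λ
  finite_inter : ∀ K : Set Λ, IsCompact K → (carrier ∩ K).Finite

/-- The measure `∑_{x ∈ ω} ε_x` with which a configuration `ω` is identified. -/
def ConfigSpace.toMeasure {Λ : Type*} [TopologicalSpace Λ] [MeasurableSpace Λ]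
    (ω : ConfigSpace Λ) : Measure Λ :=
  Measure.sum fun x : ω.carrier => Measure.dirac (x : Λ)

/-- The vague topology on configurations: the coarsest one making `ω ↦ ∫ f dω` continuous for
every continuous compactly supported `f`. -/
instance ConfigSpace.instTopologicalSpace (Λ : Type*) [TopologicalSpace Λ] [MeasurableSpace Λ] :
    TopologicalSpace (ConfigSpace Λ) :=
  ⨅ f : C_c(Λ, ℝ), TopologicalSpace.induced (fun ω => ∫ x, f x ∂ω.toMeasure) inferInstance

instance ConfigSpace.instMeasurableSpace (Λ : Type*) [TopologicalSpace Λ] [MeasurableSpace Λ] :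
    MeasurableSpace (ConfigSpace Λ) :=
  borel (ConfigSpace Λ)

instance ConfigSpace.instBorelSpace (Λ : Type*) [TopologicalSpace Λ] [MeasurableSpace Λ] :
    BorelSpace (ConfigSpace Λ) :=
  ⟨rfl⟩

/-- Positive diffuse Radon measures on `Λ`. On the spaces considered here (σ-compact, locally
compact, metric) every locally finite Borel measure is regular, and locally finite means the same
as finite on compact sets. -/
@[ext]
structure DiffuseRadonMeasure (Λ : Type*) [TopologicalSpace Λ] [MeasurableSpace Λ] where
  toMeasure : Measure Λ
  locallyFinite : IsLocallyFiniteMeasure toMeasure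
  diffuse : NullSingletonClass toMeasure

/-- The vague topology on diffuse Radon measures. -/
instance DiffuseRadonMeasure.instTopologicalSpace (Λ : Type*) [TopologicalSpace Λ]
    [MeasurableSpace Λ] : TopologicalSpace (DiffuseRadonMeasure Λ) :=
  ⨅ f : C_c(Λ, ℝ), TopologicalSpace.induced (fun m => ∫ x, f x ∂m.toMeasure) inferInstance

instance DiffuseRadonMeasure.instMeasurableSpace (Λ : Type*) [TopologicalSpace Λ]
    [MeasurableSpace Λ] : MeasurableSpace (DiffuseRadonMeasure Λ) :=
  borel (DiffuseRadonMeasure Λ)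

instance DiffuseRadonMeasure.instBorelSpace (Λ : Type*) [TopologicalSpace Λ]
    [MeasurableSpace Λ] : BorelSpace (DiffuseRadonMeasure Λ) :=
  ⟨rfl⟩

/-- `μ` is a probability measure on configurations with
`E_μ[exp (∫ f dω)] = exp (∫ (e^f - 1) dσ)` for all continuous compactly supported `f`. -/
structure IsPoissonLaw {Λ : Type*} [TopologicalSpace Λ] [MeasurableSpace Λ]
    (σ : Measure Λ) (μ : Measure (ConfigSpace Λ)) : Prop where
  isProbabilityMeasure : IsProbabilityMeasure μ
  integrable_exp : ∀ f : C_c(Λ, ℝ),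
    Integrable (fun ω : ConfigSpace Λ => Real.exp (∫ x, f x ∂ω.toMeasure)) μ
  laplace : ∀ f : C_c(Λ, ℝ),
    ∫ ω : ConfigSpace Λ, Real.exp (∫ x, f x ∂ω.toMeasure) ∂μ
      = Real.exp (∫ x, (Real.exp (f x) - 1) ∂σ)

open Classical in
/-- The Poisson measure of intensity `σ`: the probability measure on configurations which is
characterized by its Laplace functional. -/
def poissonLaw {Λ : Type*} [TopologicalSpace Λ] [MeasurableSpace Λ]
    (σ : DiffuseRadonMeasure Λ) : Measure (ConfigSpace Λ) :=
  if h : ∃ μ : Measure (ConfigSpace Λ), IsPoissonLaw σ.toMeasure μ then h.choose else 0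

/-- `dμ'_M(ω, m) = dμ_m(ω) dP(m)`: the joint law of a Cox process and of its random intensity `M`,
whose law is `P`. -/
def coxLaw {Λ : Type*} [TopologicalSpace Λ] [MeasurableSpace Λ]
    (P : Measure (DiffuseRadonMeasure Λ)) : Measure (ConfigSpace Λ × DiffuseRadonMeasure Λ) :=
  P.bind fun m => (poissonLaw m).map fun ω => (ω, m)

/-- `dμ'_σ(ω, m) = dμ_σ(ω) dP(m)`: the law of an independent couple `(N, M)`, with `N` Poisson of
intensity `σ` and `M` of law `P`. -/
def independentLaw {Λ : Type*} [TopologicalSpace Λ] [MeasurableSpace Λ]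
    (σ : DiffuseRadonMeasure Λ) (P : Measure (DiffuseRadonMeasure Λ)) :
    Measure (ConfigSpace Λ × DiffuseRadonMeasure Λ) :=
  (poissonLaw σ).prod P

/-- The total variation distance between configurations: the number of points of `Λ` which belong
to exactly one of them (possibly infinite). -/
def totalVariationDist {Λ : Type*} [TopologicalSpace Λ] (ω η : ConfigSpace Λ) : ℝ≥0∞ :=
  (((ω.carrier \ η.carrier).encard + (η.carrier \ ω.carrier).encard : ℕ∞) : ℝ≥0∞)

/-- The Rubinstein (optimal transportation) distance with cost `ρ`: the infimum of `∫ ρ dγ` over the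
probability measures `γ` on `X × X` with marginals `μ` and `ν`. -/
def rubinsteinDist {X : Type*} [MeasurableSpace X] (ρ : X → X → ℝ≥0∞) (μ ν : Measure X) : ℝ≥0∞ :=
  ⨅ (γ : Measure (X × X)) (_ : IsProbabilityMeasure γ ∧ γ.map Prod.fst = μ ∧ γ.map Prod.snd = ν),
    ∫⁻ z, ρ z.1 z.2 ∂γ

end

/-! Take a Poisson process on `Λ × ℝ` with intensity `σ ⊗ Lebesgue`, independent of the random
intensity `M`. For a density `q`, the points lying above the axis and below the graph of `q`,
projected to `Λ`, form a Poisson process of intensity `q σ`. One source therefore produces both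
marginals: the graph of `1` gives a Poisson process of intensity `σ` independent of `M`, and the
graph of `dM/dσ` gives, conditionally on `M = m`, a Poisson process of intensity `m`. The two
configurations can differ only at projections of points lying between the two graphs. By Campbell's
formula the mean number of such points, given `M = m`, is the area between the graphs, at most `∫
|dm/dσ - 1| dσ`. Keeping the same `M` on both sides and integrating over it bounds the cost of this
coupling, hence the infimum.

The source is built by hand: `intensitySeq` cuts the intensity into finite measures, and `law` puts
in each block a Poisson number of independent points. Its Laplace functional is
`integrable_exp_and_integral_exp`, and Campbell's formula is `lintegral_lintegral_points`. Since `σ`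
is diffuse, no two points share a projection (`ae_projection_injective`), so that projecting loses
no multiplicity.

Two further facts link this to the definitions. `poissonLaw` is a choice, so `IsPoissonLaw.unique`
is needed to recognize the constructed law. And `measurable_config` shows that the configuration
depends measurably on the outcome and on `m` jointly; this rests on identifying the Borel σ-algebra
of the vague topology with the one generated by the integrals `∫ f dω`. -/

/-! ### The vague topology on configurations and its Borel σ-algebra -/

section VagueTopology

open Filter Topology TopologicalSpace ProbabilityTheory

/-- On a σ-compact, locally compact metric space, countably many compactly supported functions
approximate every compactly supported function uniformly, with control of the supports. -/
theorem exists_countable_approx_compactlySupported (Λ : Type*) [MetricSpace Λ]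
    [SigmaCompactSpace Λ] [LocallyCompactSpace Λ] :
    ∃ D : Set C_c(Λ, ℝ), D.Countable ∧ ∀ f : C_c(Λ, ℝ), ∃ χ ∈ D, ∀ ε : ℝ, 0 < ε →
      ∃ g ∈ D, ∀ x, |f x - g x| ≤ ε * χ x := by
  have : SecondCountableTopology Λ := EMetric.secondCountable_of_sigmaCompact Λ
  let K := CompactExhaustion.choice Λ
  let S : ℕ → Set C_c(Λ, ℝ) := fun n => {f | ∀ x, x ∉ K n → f x = 0}
  have hχ : ∀ n, ∃ χ : C_c(Λ, ℝ), (∀ x ∈ K n, χ x = 1) ∧ ∀ x, 0 ≤ χ x := by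
    intro n
    obtain ⟨f, h1, -, h3, h4⟩ := exists_continuous_one_zero_of_isCompact (K.isCompact n)
      isClosed_empty (Set.disjoint_empty _)
    exact ⟨⟨f, h3⟩, fun x hx => h1 hx, fun x => (h4 x).1⟩
  choose χ hχ1 hχ0 using hχ
  have hD : ∀ n, ∃ D : Set C_c(Λ, ℝ), D.Countable ∧ D ⊆ S n ∧ ∀ f ∈ S n, ∀ ε : ℝ, 0 < ε →
      ∃ g ∈ D, ∀ x ∈ K n, |f x - g x| < ε := by
    intro n
    -- Separability is applied to `T` itself, not to all of `C(Λ, ℝ)`, so that the approximants also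
    -- vanish outside `K n`.
    let T : Set C(Λ, ℝ) := (fun f : C_c(Λ, ℝ) => f.toContinuousMap) '' S n
    obtain ⟨s, hsc, hsd⟩ := TopologicalSpace.exists_countable_dense T
    have hlift : ∀ t : T, ∃ f ∈ S n, f.toContinuousMap = (t : C(Λ, ℝ)) := fun t => t.2
    choose lift hl1 hl2 using hlift
    refine ⟨lift '' s, hsc.image _, ?_, ?_⟩
    · rintro _ ⟨t, -, rfl⟩
      exact hl1 t
    · intro f hf ε hε
      have hcont : Tendsto (fun t : T => (t : C(Λ, ℝ))) (𝓝 ⟨f.toContinuousMap, f, hf, rfl⟩)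
          (𝓝 f.toContinuousMap) := continuous_subtype_val.tendsto _
      rw [ContinuousMap.tendsto_iff_forall_isCompact_tendstoUniformlyOn] at hcont
      have h := Metric.tendstoUniformlyOn_iff.1 (hcont (K n) (K.isCompact n)) ε hε
      obtain ⟨t, ht, hts⟩ := hsd.inter_nhds_nonempty h
      refine ⟨lift t, ⟨t, ht, rfl⟩, fun x hx => ?_⟩
      have := hts x hx
      rw [← hl2 t] at this
      exact this
  choose D hDc hDS hDapp using hD
  refine ⟨Set.range χ ∪ ⋃ n, D n, (Set.countable_range χ).union (Set.countable_iUnion hDc), ?_⟩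
  intro f
  obtain ⟨n, hn⟩ := K.exists_superset_of_isCompact f.hasCompactSupport
  have hfS : f ∈ S n := fun x hx => by
    by_contra h
    exact hx (hn (subset_tsupport _ h))
  refine ⟨χ n, Or.inl ⟨n, rfl⟩, fun ε hε => ?_⟩
  obtain ⟨g, hg, hfg⟩ := hDapp n f hfS ε hε
  refine ⟨g, Or.inr (Set.mem_iUnion.2 ⟨n, hg⟩), fun x => ?_⟩
  by_cases hx : x ∈ K n
  · rw [hχ1 n x hx, mul_one]
    exact (hfg x hx).le
  · rw [hfS x hx, hDS n hg x hx, sub_zero, abs_zero]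
    exact mul_nonneg hε.le (hχ0 n x)

namespace ConfigSpace

variable {Λ : Type*}

theorem toMeasure_eq_map_count [TopologicalSpace Λ] [MeasurableSpace Λ] (ω : ConfigSpace Λ) :
    ω.toMeasure = (Measure.sum fun x : ω.carrier => Measure.dirac x).map Subtype.val := by
  rw [toMeasure, Measure.map_sum measurable_subtype_coe.aemeasurable]
  simp_rw [Measure.map_dirac' measurable_subtype_coe]

theorem toMeasure_apply [TopologicalSpace Λ] [MeasurableSpace Λ] (ω : ConfigSpace Λ)
    {s : Set Λ} (hs : MeasurableSet s) :
    ω.toMeasure s = ((ω.carrier ∩ s).encard : ℝ≥0∞) := by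
  have h := Measure.count_apply (measurable_subtype_coe hs : MeasurableSet
    ((Subtype.val : ω.carrier → Λ) ⁻¹' s))
  rw [toMeasure_eq_map_count, Measure.map_apply measurable_subtype_coe hs]
  refine h.trans ?_
  rw [← Subtype.val_injective.encard_image, Subtype.image_preimage_coe]

instance [TopologicalSpace Λ] [T2Space Λ] [MeasurableSpace Λ] [OpensMeasurableSpace Λ]
    (ω : ConfigSpace Λ) : IsFiniteMeasureOnCompacts ω.toMeasure where
  lt_top_of_isCompact K hK := by
    rw [ω.toMeasure_apply hK.measurableSet]
    have := (ω.finite_inter K hK).encard_lt_top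
    rw [← ENat.toENNReal_lt_top] at this
    exact this

theorem integrable [TopologicalSpace Λ] [T2Space Λ] [MeasurableSpace Λ] [OpensMeasurableSpace Λ]
    (ω : ConfigSpace Λ) (f : C_c(Λ, ℝ)) : Integrable f ω.toMeasure :=
  f.continuous.integrable_of_hasCompactSupport f.hasCompactSupport

theorem measurable_integral [TopologicalSpace Λ] [MeasurableSpace Λ] (f : C_c(Λ, ℝ)) :
    Measurable fun ω : ConfigSpace Λ => ∫ x, f x ∂ω.toMeasure :=
  Continuous.measurable <| continuous_iff_le_induced.2 <|
    iInf_le (fun f : C_c(Λ, ℝ) => TopologicalSpace.induced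
      (fun ω : ConfigSpace Λ => ∫ x, f x ∂ω.toMeasure) inferInstance) f

variable [MetricSpace Λ] [SigmaCompactSpace Λ] [LocallyCompactSpace Λ] [MeasurableSpace Λ]
  [BorelSpace Λ]

/-- For an uncountable family of functionals, the Borel σ-algebra of the initial topology may exceed
the generated σ-algebra. Countably many functionals embed the topology in a second countable
product, where the two agree. -/
theorem exists_countable_topology_eq : ∃ D : Set C_c(Λ, ℝ), D.Countable ∧
    instTopologicalSpace Λ = TopologicalSpace.induced
      (fun (ω : ConfigSpace Λ) (f : D) => ∫ x, (f : C_c(Λ, ℝ)) x ∂ω.toMeasure)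
      Pi.topologicalSpace := by
  obtain ⟨D, hDc, hD⟩ := exists_countable_approx_compactlySupported Λ
  refine ⟨D, hDc, le_antisymm ?_ ?_⟩
  · rw [← continuous_iff_le_induced]
    refine continuous_pi fun f => ?_
    exact continuous_iff_le_induced.2 <|
      iInf_le (fun f : C_c(Λ, ℝ) => TopologicalSpace.induced
        (fun ω : ConfigSpace Λ => ∫ x, f x ∂ω.toMeasure) inferInstance) f
  · refine le_iInf fun f => ?_
    rw [← continuous_iff_le_induced]
    let Φ : ConfigSpace Λ → D → ℝ := fun ω f => ∫ x, (f : C_c(Λ, ℝ)) x ∂ω.toMeasure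
    let τ : TopologicalSpace (ConfigSpace Λ) := TopologicalSpace.induced Φ Pi.topologicalSpace
    have hΦ : Continuous Φ := continuous_induced_dom
    have hcD : ∀ g (_ : g ∈ D), Continuous fun ω : ConfigSpace Λ => ∫ x, g x ∂ω.toMeasure :=
      fun g hg => (continuous_apply (⟨g, hg⟩ : D)).comp hΦ
    change Continuous fun ω : ConfigSpace Λ => ∫ x, f x ∂ω.toMeasure
    obtain ⟨χ, hχ, happ⟩ := hD f
    choose g hgD hg using fun n : ℕ => happ (1 / ((n : ℝ) + 1)) Nat.one_div_pos_of_nat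
    have key : TendstoLocallyUniformly (fun n (ω : ConfigSpace Λ) => ∫ x, g n x ∂ω.toMeasure)
        (fun ω => ∫ x, f x ∂ω.toMeasure) atTop := by
      rw [Metric.tendstoLocallyUniformly_iff]
      intro ε hε ω₀
      set c := ∫ x, χ x ∂ω₀.toMeasure
      -- The error is at most `∫ χ dω / (n + 1)`. The total `∫ χ dω` need not be bounded over all
      -- configurations, but it is on this neighbourhood, so the convergence is locally uniform.
      refine ⟨{ω | ∫ x, χ x ∂ω.toMeasure < |c| + 1},
        (isOpen_Iio.preimage (hcD χ hχ)).mem_nhds (lt_of_le_of_lt (le_abs_self c) (by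
          simp)), ?_⟩
      have hlim : Tendsto (fun n : ℕ => 1 / ((n : ℝ) + 1) * (|c| + 1)) atTop (𝓝 0) := by
        simpa using tendsto_one_div_add_atTop_nhds_zero_nat.mul_const (|c| + 1)
      filter_upwards [hlim.eventually_lt_const hε] with n hn ω hω
      refine lt_of_le_of_lt ?_ hn
      rw [Real.dist_eq, ← integral_sub (ω.integrable f) (ω.integrable (g n))]
      calc |∫ x, f x - g n x ∂ω.toMeasure| ≤ ∫ x, |f x - g n x| ∂ω.toMeasure :=
            abs_integral_le_integral_abs
        _ ≤ ∫ x, 1 / ((n : ℝ) + 1) * χ x ∂ω.toMeasure :=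
            integral_mono ((ω.integrable f).sub (ω.integrable (g n))).abs
              ((ω.integrable χ).const_mul _) (hg n)
        _ = 1 / ((n : ℝ) + 1) * ∫ x, χ x ∂ω.toMeasure := integral_const_mul _ _
        _ ≤ _ := mul_le_mul_of_nonneg_left (le_of_lt hω) (by positivity)
    exact key.continuous (Frequently.of_forall fun n => hcD _ (hgD n))

/-- The Borel σ-algebra of the vague topology is generated by the maps `ω ↦ ∫ f dω`. -/
theorem instMeasurableSpace_eq_comap :
    instMeasurableSpace Λ = MeasurableSpace.comap
      (fun (ω : ConfigSpace Λ) (f : C_c(Λ, ℝ)) => ∫ x, f x ∂ω.toMeasure)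
      MeasurableSpace.pi := by
  apply le_antisymm
  · obtain ⟨D, hDc, hD⟩ := exists_countable_topology_eq (Λ := Λ)
    have : Countable D := hDc
    rw [instMeasurableSpace, hD, borel_comap, ← BorelSpace.measurable_eq (α := D → ℝ)]
    have : (fun (ω : ConfigSpace Λ) (f : D) => ∫ x, (f : C_c(Λ, ℝ)) x ∂ω.toMeasure)
        = (fun (u : C_c(Λ, ℝ) → ℝ) (f : D) => u f) ∘
          fun (ω : ConfigSpace Λ) (f : C_c(Λ, ℝ)) => ∫ x, f x ∂ω.toMeasure := rfl
    rw [this, ← MeasurableSpace.comap_comp]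
    exact MeasurableSpace.comap_mono (Measurable.comap_le (by fun_prop))
  · exact Measurable.comap_le (measurable_pi_lambda _ fun f => measurable_integral f)

/-- Each generating integral `∫ f dω` is a difference of two lower integrals, and these are
measurable functions of the measure. -/
theorem measurable_of_measurable_toMeasure {α : Type*} [MeasurableSpace α]
    {N : α → ConfigSpace Λ}
    (hN : ∀ s, MeasurableSet s → Measurable fun a => (N a).toMeasure s) : Measurable N := by
  have hN' : Measurable fun a => (N a).toMeasure := Measure.measurable_of_measurable_coe _ hN
  suffices h : Measurable fun a (f : C_c(Λ, ℝ)) => ∫ x, f x ∂(N a).toMeasure by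
    intro t ht
    rw [instMeasurableSpace_eq_comap] at ht
    obtain ⟨u, hu, rfl⟩ := ht
    exact h hu
  refine measurable_pi_lambda _ fun f => ?_
  have h : ∀ a, ∫ x, f x ∂(N a).toMeasure = (∫⁻ x, ENNReal.ofReal (f x) ∂(N a).toMeasure).toReal
      - (∫⁻ x, ENNReal.ofReal (-f x) ∂(N a).toMeasure).toReal := fun a =>
    integral_eq_lintegral_pos_part_sub_lintegral_neg_part ((N a).integrable f)
  have hf : Measurable f := f.continuous.measurable
  simp only [h]
  exact ((Measure.measurable_lintegral (by fun_prop)).comp hN').ennreal_toReal.sub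
    ((Measure.measurable_lintegral (by fun_prop)).comp hN').ennreal_toReal

end ConfigSpace

end VagueTopology

/-! ### Uniqueness of the Poisson law -/

section Uniqueness

open ProbabilityTheory


variable {Λ : Type*}

namespace ConfigSpace

theorem integral_smul_compactlySupported [TopologicalSpace Λ] [MeasurableSpace Λ]
    (ω : ConfigSpace Λ) (t : ℝ) (f : C_c(Λ, ℝ)) :
    ∫ x, (t • f) x ∂ω.toMeasure = t * ∫ x, f x ∂ω.toMeasure := by
  simp only [CompactlySupportedContinuousMap.smul_apply, smul_eq_mul]
  exact integral_const_mul _ _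

theorem integral_sum_smul_compactlySupported {ι : Type*} [TopologicalSpace Λ]
    [T2Space Λ] [MeasurableSpace Λ] [OpensMeasurableSpace Λ] (ω : ConfigSpace Λ) (s : Finset ι)
    (t : ι → ℝ) (f : ι → C_c(Λ, ℝ)) :
    ∫ x, (∑ i ∈ s, t i • f i) x ∂ω.toMeasure = ∑ i ∈ s, t i * ∫ x, f i x ∂ω.toMeasure := by
  simp only [CompactlySupportedContinuousMap.sum_apply]
  rw [integral_finsetSum _ fun i _ => ω.integrable (t i • f i)]
  exact Finset.sum_congr rfl fun i _ => ω.integral_smul_compactlySupported _ _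

variable [MetricSpace Λ] [SigmaCompactSpace Λ] [LocallyCompactSpace Λ]
  [MeasurableSpace Λ] [BorelSpace Λ]

/-- A probability measure on configurations is determined by the characteristic functions of the
linear functionals `ω ↦ ∫ f dω`. -/
theorem measure_ext_of_charFun {μ μ' : Measure (ConfigSpace Λ)} [IsProbabilityMeasure μ]
    [IsProbabilityMeasure μ']
    (h : ∀ f : C_c(Λ, ℝ), ∫ ω, Complex.exp ((∫ x, f x ∂ω.toMeasure : ℝ) * Complex.I) ∂μ
      = ∫ ω, Complex.exp ((∫ x, f x ∂ω.toMeasure : ℝ) * Complex.I) ∂μ') : μ = μ' := by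
  let Y : ConfigSpace Λ → C_c(Λ, ℝ) → ℝ := fun ω f => ∫ x, f x ∂ω.toMeasure
  have hY : Measurable Y := measurable_pi_lambda _ fun f => measurable_integral f
  suffices hmap : μ.map Y = μ'.map Y by
    ext s hs
    rw [instMeasurableSpace_eq_comap] at hs
    obtain ⟨u, hu, rfl⟩ := hs
    rw [← Measure.map_apply hY hu, ← Measure.map_apply hY hu, hmap]
  have : IsProbabilityMeasure (μ.map Y) := Measure.isProbabilityMeasure_map hY.aemeasurable
  have : IsProbabilityMeasure (μ'.map Y) := Measure.isProbabilityMeasure_map hY.aemeasurable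
  -- It suffices to compare the finite-dimensional marginals of the family of integrals.
  refine IsProjectiveLimit.unique (P := fun I : Finset C_c(Λ, ℝ) => (μ.map Y).map I.restrict)
    (fun I => rfl) fun I => ?_
  change _ = (μ.map Y).map I.restrict
  have hr : Measurable (I.restrict (π := fun _ => ℝ)) := Finset.measurable_restrict I
  have hrY : Measurable (I.restrict ∘ Y) := hr.comp hY
  rw [Measure.map_map hr hY, Measure.map_map hr hY]
  have : IsProbabilityMeasure (μ.map (I.restrict ∘ Y)) :=
    Measure.isProbabilityMeasure_map hrY.aemeasurable
  have : IsProbabilityMeasure (μ'.map (I.restrict ∘ Y)) :=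
    Measure.isProbabilityMeasure_map hrY.aemeasurable
  symm
  refine Measure.ext_of_charFunDual (E := I → ℝ) (funext fun L => ?_)
  classical
  -- By linearity, a functional of finitely many integrals is the integral of a single function, so
  -- the hypothesis covers every finite-dimensional characteristic function.
  have hL : ∀ ω, L (I.restrict (Y ω))
      = ∫ x, (∑ i : I, L (Pi.single i 1) • (i : C_c(Λ, ℝ))) x ∂ω.toMeasure := by
    intro ω
    rw [integral_sum_smul_compactlySupported, ← ContinuousLinearMap.coe_coe,
      LinearMap.pi_apply_eq_sum_univ (L : (I → ℝ) →ₗ[ℝ] ℝ)]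
    refine Finset.sum_congr rfl fun i _ => ?_
    rw [smul_eq_mul, mul_comm]
    congr 2
    ext j
    simp [Pi.single_apply, eq_comm]
  rw [charFunDual_apply, charFunDual_apply, integral_map hrY.aemeasurable (by fun_prop),
    integral_map hrY.aemeasurable (by fun_prop)]
  simp only [Function.comp_apply, hL]
  exact h _

end ConfigSpace

variable [MetricSpace Λ] [SigmaCompactSpace Λ] [LocallyCompactSpace Λ]
  [MeasurableSpace Λ] [BorelSpace Λ]

/-- The Poisson law is characterized by its Laplace functional. -/
theorem IsPoissonLaw.unique {σ : Measure Λ} {μ μ' : Measure (ConfigSpace Λ)}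
    (h : IsPoissonLaw σ μ) (h' : IsPoissonLaw σ μ') : μ = μ' := by
  have := h.isProbabilityMeasure
  have := h'.isProbabilityMeasure
  refine ConfigSpace.measure_ext_of_charFun fun f => ?_
  let Y : ConfigSpace Λ → ℝ := fun ω => ∫ x, f x ∂ω.toMeasure
  have hmgf : mgf Y μ = mgf Y μ' := by
    ext t
    have h1 := h.laplace (t • f)
    rw [← h'.laplace (t • f)] at h1
    simp only [ConfigSpace.integral_smul_compactlySupported] at h1
    exact h1
  have hset : integrableExpSet Y μ = Set.univ := by
    refine Set.eq_univ_of_forall fun t => ?_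
    have h1 := h.integrable_exp (t • f)
    simp only [ConfigSpace.integral_smul_compactlySupported] at h1
    exact h1
  -- The moment generating function is finite on all of `ℝ`, so equality on the real line continues
  -- analytically to the imaginary axis.
  have h2 := eqOn_complexMGF_of_mgf hmgf (x := Complex.I) (by simp [hset])
  simpa only [complexMGF, mul_comm Complex.I] using h2

theorem IsPoissonLaw.poissonLaw_eq {m : DiffuseRadonMeasure Λ} {μ : Measure (ConfigSpace Λ)}
    (h : IsPoissonLaw m.toMeasure μ) : poissonLaw m = μ := by
  have hex : ∃ μ : Measure (ConfigSpace Λ), IsPoissonLaw m.toMeasure μ := ⟨μ, h⟩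
  rw [poissonLaw, dif_pos hex]
  exact hex.choose_spec.unique h

end Uniqueness

/-! ### Construction of the Poisson process and Campbell's formula -/

section PoissonProcess

open Filter Topology ProbabilityTheory
open scoped NNReal Nat

theorem lintegral_poissonMeasure (r : ℝ≥0) (f : ℕ → ℝ≥0∞) :
    ∫⁻ n, f n ∂poissonMeasure r
      = ∑' n : ℕ, ENNReal.ofReal (Real.exp (-r) * r ^ n / n !) * f n := by
  rw [poissonMeasure, lintegral_sum_measure]
  simp_rw [lintegral_smul_measure, lintegral_dirac, smul_eq_mul]

theorem lintegral_pow_poissonMeasure (r c : ℝ≥0) :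
    ∫⁻ n, (c : ℝ≥0∞) ^ n ∂poissonMeasure r = ENNReal.ofReal (Real.exp (r * c - r)) := by
  rw [lintegral_poissonMeasure]
  -- Up to the factor `exp (r c - r)`, the terms of the series are the weights of the Poisson law of
  -- parameter `r c`.
  have h := (hasSum_one_poissonMeasure (r * c)).mul_left (Real.exp (r * c - r))
  rw [mul_one] at h
  rw [← h.tsum_eq, ENNReal.ofReal_tsum_of_nonneg (fun n => by positivity) h.summable]
  refine tsum_congr fun n => ?_
  rw [← ENNReal.ofReal_coe_nnreal, ← ENNReal.ofReal_pow c.coe_nonneg,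
    ← ENNReal.ofReal_mul (by positivity)]
  congr 1
  have : Real.exp (-(r : ℝ)) = Real.exp (r * c - r) * Real.exp (-(r * c)) := by
    rw [← Real.exp_add]; ring_nf
  rw [this, NNReal.coe_mul, mul_pow]
  ring

theorem lintegral_natCast_poissonMeasure (r : ℝ≥0) :
    ∫⁻ n, (n : ℝ≥0∞) ∂poissonMeasure r = r := by
  rw [lintegral_poissonMeasure, tsum_eq_zero_add' ENNReal.summable]
  have h : ∀ n : ℕ, ENNReal.ofReal (Real.exp (-r) * r ^ (n + 1) / (n + 1)!) * ((n + 1 : ℕ) : ℝ≥0∞)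
      = r * (ENNReal.ofReal (Real.exp (-r) * r ^ n / n !) * 1) := by
    intro n
    rw [← ENNReal.ofReal_natCast, ← ENNReal.ofReal_coe_nnreal,
      ← ENNReal.ofReal_mul (by positivity), mul_one, ← ENNReal.ofReal_mul (by positivity)]
    congr 1
    rw [Nat.factorial_succ]
    push_cast
    field_simp
    ring
  simp_rw [h]
  rw [ENNReal.tsum_mul_left, ← lintegral_poissonMeasure]
  simp

/-- This is the tail-sum formula for the mean. The `i`-th position of a block is used exactly when
the block has more than `i` points, which is the form met in Campbell's formula. -/
theorem tsum_poissonMeasure_lt (r : ℝ≥0) : ∑' i : ℕ, poissonMeasure r {n | i < n} = r := by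
  rw [← lintegral_natCast_poissonMeasure]
  have h : ∀ n : ℕ, (n : ℝ≥0∞) = ∑' i : ℕ, {n : ℕ | i < n}.indicator 1 n := by
    intro n
    rw [tsum_eq_sum (s := Finset.range n) fun i hi => by simpa using hi]
    rw [Finset.sum_congr rfl fun i hi => Set.indicator_of_mem
      (show n ∈ {n : ℕ | i < n} from Finset.mem_range.1 hi) 1]
    simp
  simp_rw [h]
  rw [lintegral_tsum fun i => by fun_prop]
  simp_rw [lintegral_indicator_one (MeasurableSet.of_discrete)]

namespace PoissonProcess

variable {E : Type*} [MeasurableSpace E]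

/-- Outcomes of a countable family of blocks: the number of points of each block, and a sequence
of positions for each block. -/
abbrev Sample (E : Type*) := (ℕ → ℕ) × (ℕ × ℕ → E)

/-- The law for which the block `k` has a Poisson number of points, independent with the
normalization of `ν k` as their common law. -/
noncomputable def law [Nonempty E] (ν : ℕ → FiniteMeasure E) : Measure (Sample E) :=
  (Measure.infinitePi fun k => poissonMeasure (ν k).mass).prod
    (Measure.infinitePi fun ι : ℕ × ℕ => ((ν ι.1).normalize : Measure E))

instance [Nonempty E] (ν : ℕ → FiniteMeasure E) : IsProbabilityMeasure (law ν) := by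
  unfold law; infer_instance

/-- The counting measure of the points of an outcome. -/
noncomputable def points (a : Sample E) : Measure E :=
  Measure.sum fun ι : ℕ × ℕ => if ι.2 < a.1 ι.1 then Measure.dirac (a.2 ι) else 0

theorem lintegral_points (a : Sample E) {G : E → ℝ≥0∞} (hG : Measurable G) :
    ∫⁻ x, G x ∂points a = ∑' ι : ℕ × ℕ, if ι.2 < a.1 ι.1 then G (a.2 ι) else 0 := by
  rw [points, lintegral_sum_measure]
  refine tsum_congr fun ι => ?_
  split_ifs
  · rw [lintegral_dirac' _ hG]
  · rw [lintegral_zero_measure]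

theorem measurableSet_active (ι : ℕ × ℕ) : MeasurableSet {a : Sample E | ι.2 < a.1 ι.1} :=
  measurableSet_lt measurable_const (by fun_prop)

theorem measurable_lintegral_points {β : Type*} [MeasurableSpace β] {G : β → E → ℝ≥0∞}
    (hG : Measurable (Function.uncurry G)) :
    Measurable fun z : Sample E × β => ∫⁻ x, G z.2 x ∂points z.1 := by
  have : ∀ z : Sample E × β, ∫⁻ x, G z.2 x ∂points z.1
      = ∑' ι : ℕ × ℕ, if ι.2 < z.1.1 ι.1 then G z.2 (z.1.2 ι) else 0 := fun z =>
    lintegral_points _ (hG.comp measurable_prodMk_left)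
  simp_rw [this]
  refine Measurable.tsum fun ι => Measurable.ite (measurable_fst (measurableSet_active ι)) ?_
    measurable_const
  exact hG.comp (f := fun z : Sample E × β => (z.2, z.1.2 ι)) (by fun_prop)

variable [Nonempty E] (ν : ℕ → FiniteMeasure E)

theorem lintegral_eq_mass_mul_normalize (μ : FiniteMeasure E) (G : E → ℝ≥0∞) :
    ∫⁻ x, G x ∂(μ : Measure E) = μ.mass * ∫⁻ x, G x ∂(μ.normalize : Measure E) := by
  conv_lhs => rw [μ.self_eq_mass_smul_normalize]
  rw [FiniteMeasure.toMeasure_smul, lintegral_smul_measure]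
  rfl

/-- Campbell's formula. -/
theorem lintegral_lintegral_points {G : E → ℝ≥0∞} (hG : Measurable G) :
    ∫⁻ a, ∫⁻ x, G x ∂points a ∂law ν = ∫⁻ x, G x ∂Measure.sum fun k => (ν k : Measure E) := by
  simp_rw [lintegral_points _ hG]
  rw [lintegral_tsum fun ι => ((Measurable.ite (measurableSet_active ι) (by fun_prop)
    measurable_const).aemeasurable)]
  have h : ∀ ι : ℕ × ℕ, ∫⁻ a, (if ι.2 < a.1 ι.1 then G (a.2 ι) else 0) ∂law ν
      = poissonMeasure (ν ι.1).mass {n | ι.2 < n}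
        * ∫⁻ x, G x ∂((ν ι.1).normalize : Measure E) := by
    intro ι
    have h1 : ∀ a : Sample E, (if ι.2 < a.1 ι.1 then G (a.2 ι) else 0)
        = {n : ℕ | ι.2 < n}.indicator 1 (a.1 ι.1) * G (a.2 ι) := by
      intro a
      by_cases ha : ι.2 < a.1 ι.1 <;> simp [ha]
    simp_rw [h1]
    rw [law, lintegral_prod_mul
      (f := fun n : ℕ → ℕ => {n : ℕ | ι.2 < n}.indicator (1 : ℕ → ℝ≥0∞) (n ι.1))
      (g := fun x : ℕ × ℕ → E => G (x ι))
      ((Measurable.of_discrete (f := {n : ℕ | ι.2 < n}.indicator (1 : ℕ → ℝ≥0∞))).comp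
        (measurable_pi_apply ι.1)).aemeasurable
      (hG.comp (measurable_pi_apply ι)).aemeasurable]
    congr 1
    · rw [← lintegral_indicator_one (MeasurableSet.of_discrete)]
      exact (measurePreserving_eval_infinitePi (fun k => poissonMeasure (ν k).mass)
        ι.1).lintegral_comp (f := {n : ℕ | ι.2 < n}.indicator 1) Measurable.of_discrete
    · exact (measurePreserving_eval_infinitePi
        (fun ι : ℕ × ℕ => ((ν ι.1).normalize : Measure E)) ι).lintegral_comp hG
  simp_rw [h]
  rw [ENNReal.tsum_prod (f := fun k i => poissonMeasure (ν k).mass {n | i < n}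
    * ∫⁻ x, G x ∂((ν k).normalize : Measure E)), lintegral_sum_measure]
  refine tsum_congr fun k => ?_
  rw [ENNReal.tsum_mul_right, tsum_poissonMeasure_lt, ← lintegral_eq_mass_mul_normalize]

/-- Two distinct positions are independent, and the law of the second charges no fibre of `π`, so by
Fubini a coincidence is null. There are only countably many pairs. -/
theorem ae_projection_injective {Λ : Type*} [MeasurableSpace Λ] [MeasurableEq Λ]
    [MeasurableSingletonClass Λ] {π : E → Λ} (hπ : Measurable π)
    (h : ∀ k x, (ν k : Measure E) (π ⁻¹' {x}) = 0) :
    ∀ᵐ a ∂law ν, ∀ ι ι' : ℕ × ℕ, ι.2 < a.1 ι.1 → ι'.2 < a.1 ι'.1 →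
      π (a.2 ι) = π (a.2 ι') → ι = ι' := by
  rw [ae_all_iff]; intro ι
  rw [ae_all_iff]; intro ι'
  by_cases hι : ι = ι'
  · exact Eventually.of_forall fun _ _ _ _ => hι
  -- For a zero block, `normalize` is a default law which may charge fibres; but then the Poisson
  -- number of points is almost surely `0`.
  by_cases h0 : ν ι'.1 = 0
  · have h1 : ∀ᵐ n : ℕ ∂poissonMeasure (ν ι'.1).mass, (n : ℝ≥0∞) = 0 := by
      have := lintegral_natCast_poissonMeasure (ν ι'.1).mass
      rw [h0, FiniteMeasure.zero_mass, ENNReal.coe_zero,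
        lintegral_eq_zero_iff Measurable.of_discrete] at this
      rw [h0, FiniteMeasure.zero_mass]
      exact this
    have h2 := (measurePreserving_eval_infinitePi (fun k => poissonMeasure (ν k).mass)
      ι'.1).quasiMeasurePreserving.ae h1
    have h3 := (measurePreserving_fst (μ := Measure.infinitePi fun k => poissonMeasure (ν k).mass)
      (ν := Measure.infinitePi fun ι : ℕ × ℕ =>
        ((ν ι.1).normalize : Measure E))).quasiMeasurePreserving.ae h2
    filter_upwards [h3] with a ha _ hn
    have : a.1 ι'.1 = 0 := by exact_mod_cast ha
    omega
  · have hs : MeasurableSet {y : E × E | π y.1 = π y.2} :=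
      measurableSet_eq_fun (by fun_prop) (by fun_prop)
    have h1 : ∀ᵐ y : E × E ∂((ν ι.1).normalize : Measure E).prod (ν ι'.1).normalize,
        π y.1 ≠ π y.2 := by
      rw [ae_iff]
      simp only [ne_eq, not_not]
      rw [Measure.measure_prod_null hs]
      refine Eventually.of_forall fun x => ?_
      have h2 : Prod.mk x ⁻¹' {y : E × E | π y.1 = π y.2} = π ⁻¹' {π x} := by
        ext y
        simp [eq_comm]
      change ((ν ι'.1).normalize : Measure E) (Prod.mk x ⁻¹' {y : E × E | π y.1 = π y.2}) = 0
      rw [h2, FiniteMeasure.toMeasure_normalize_eq_of_nonzero _ h0, Measure.smul_apply, h,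
        smul_zero]
    rw [← Measure.infinitePi_map_eval_prod
      (P := fun ι : ℕ × ℕ => ((ν ι.1).normalize : Measure E)) hι] at h1
    have h2 := ae_of_ae_map (by fun_prop) h1
    have h3 := (measurePreserving_snd (μ := Measure.infinitePi fun k => poissonMeasure (ν k).mass)
      (ν := Measure.infinitePi fun ι : ℕ × ℕ =>
        ((ν ι.1).normalize : Measure E))).quasiMeasurePreserving.ae h2
    filter_upwards [h3] with a ha _ _ hn
    exact absurd hn ha

end PoissonProcess

end PoissonProcess

/-! ### The Laplace functional of the Poisson process -/

section PoissonProcessLaplace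

open Filter Topology ProbabilityTheory
open scoped NNReal

namespace PoissonProcess

variable {E : Type*} [MeasurableSpace E]

/-- The sum of `g` over the points of the first `K` blocks. -/
noncomputable def partialSum (g : E → ℝ) (K : ℕ) (a : Sample E) : ℝ :=
  ∑ k ∈ Finset.range K, ∑ i ∈ Finset.range (a.1 k), g (a.2 (k, i))

theorem measurable_partialSum {g : E → ℝ} (hg : Measurable g) (K : ℕ) :
    Measurable (partialSum g K) := by
  refine Finset.measurable_fun_sum _ fun k _ => ?_
  have h : Measurable fun z : ℕ × (ℕ × ℕ → E) => ∑ i ∈ Finset.range z.1, g (z.2 (k, i)) :=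
    measurable_from_prod_countable_right fun n =>
      Finset.measurable_fun_sum (Finset.range n) fun i _ => hg.comp (measurable_pi_apply (k, i))
  exact h.comp (f := fun a : Sample E => (a.1 k, a.2)) (by fun_prop)

/-- If `g` is integrable for the counting measure of the points, its integral is the limit of the
partial sums over blocks. -/
theorem tendsto_partialSum {g : E → ℝ} (hg : Measurable g) {a : Sample E}
    (ha : Integrable g (points a)) :
    Tendsto (fun K => partialSum g K a) atTop (𝓝 (∫ x, g x ∂points a)) := by
  have h := hasSum_integral_measure ha
  have h' : ∀ ι : ℕ × ℕ, ∫ x, g x ∂(if ι.2 < a.1 ι.1 then Measure.dirac (a.2 ι) else 0)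
      = if ι.2 < a.1 ι.1 then g (a.2 ι) else 0 := by
    intro ι
    split_ifs
    · exact integral_dirac' _ _ hg.stronglyMeasurable
    · exact integral_zero_measure _
  simp_rw [h'] at h
  refine (h.prod_fiberwise (g := fun k => ∑ i ∈ Finset.range (a.1 k), g (a.2 (k, i)))
    fun k => ?_).tendsto_sum_nat
  have h1 : HasSum (fun i => if i < a.1 k then g (a.2 (k, i)) else 0)
      (∑ i ∈ Finset.range (a.1 k), if i < a.1 k then g (a.2 (k, i)) else 0) :=
    hasSum_sum_of_ne_finset_zero fun i hi => if_neg (by simpa using hi)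
  rwa [Finset.sum_congr rfl fun i hi => if_pos (Finset.mem_range.1 hi)] at h1

theorem integrable_exp_of_bounded {μ : Measure E} [IsFiniteMeasure μ] {g : E → ℝ}
    (hg : Measurable g) {C : ℝ} (hC : ∀ x, |g x| ≤ C) : Integrable (fun x => Real.exp (g x)) μ :=
  Integrable.of_bound (by fun_prop) (Real.exp C) <| Eventually.of_forall fun x => by
    rw [Real.norm_eq_abs, Real.abs_exp]
    exact Real.exp_le_exp.2 ((le_abs_self _).trans (hC x))

/-- The bound is `|e^t - 1| ≤ |t| e^{|t|}`, with the exponential factor bounded by `e^C`. -/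
theorem integrable_exp_sub_one {μ : Measure E} {g : E → ℝ} (hg : Measurable g) {C : ℝ}
    (hC : ∀ x, |g x| ≤ C) (hint : Integrable g μ) :
    Integrable (fun x => Real.exp (g x) - 1) μ := by
  refine (hint.abs.mul_const (Real.exp C)).mono (by fun_prop) (Eventually.of_forall fun x => ?_)
  rw [Real.norm_eq_abs, Real.norm_eq_abs, abs_mul, abs_abs, Real.abs_exp]
  have h1 : |g x| * Real.exp |g x| ≤ |g x| * Real.exp C :=
    mul_le_mul_of_nonneg_left (Real.exp_le_exp.2 (hC x)) (abs_nonneg _)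
  refine le_trans ?_ h1
  rw [abs_le]
  have h2 := Real.add_one_le_exp (g x)
  have h3 := Real.add_one_le_exp (-g x)
  have h4 : 1 ≤ Real.exp |g x| := Real.one_le_exp (abs_nonneg _)
  have h5 : Real.exp (g x) * Real.exp (-g x) = 1 := by rw [← Real.exp_add]; simp
  have h6 : Real.exp (g x) ≤ Real.exp |g x| := Real.exp_le_exp.2 (le_abs_self _)
  have h7 := Real.exp_pos (g x)
  constructor
  · nlinarith [neg_abs_le (g x), abs_nonneg (g x)]
  · have h8 : Real.exp (g x) - 1 ≤ g x * Real.exp (g x) := by nlinarith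
    have h9 : g x * Real.exp (g x) ≤ |g x| * Real.exp |g x| :=
      mul_le_mul (le_abs_self _) h6 h7.le (abs_nonneg _)
    linarith

theorem abs_partialSum_le {g : E → ℝ} (hg : Measurable g) {a : Sample E}
    (ha : Integrable g (points a)) (K : ℕ) : |partialSum g K a| ≤ ∫ x, |g x| ∂points a := by
  have h1 : |partialSum g K a| ≤ partialSum (fun x => |g x|) K a :=
    (Finset.abs_sum_le_sum_abs _ _).trans
      (Finset.sum_le_sum fun _ _ => Finset.abs_sum_le_sum_abs _ _)
  have hmono : Monotone fun K => partialSum (fun x => |g x|) K a := fun K L hKL =>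
    Finset.sum_le_sum_of_subset_of_nonneg (Finset.range_mono hKL)
      fun _ _ _ => Finset.sum_nonneg fun _ _ => abs_nonneg _
  exact h1.trans (hmono.ge_of_tendsto (tendsto_partialSum (by fun_prop) ha.abs) K)

theorem tendsto_exp_sum_integral (ν : ℕ → FiniteMeasure E) {g : E → ℝ}
    (hint : Integrable (fun x => Real.exp (g x) - 1) (Measure.sum fun k => (ν k : Measure E))) :
    Tendsto (fun K => Real.exp (∑ k ∈ Finset.range K, ∫ x, (Real.exp (g x) - 1) ∂(ν k : Measure E)))
      atTop (𝓝 (Real.exp (∫ x, (Real.exp (g x) - 1) ∂Measure.sum fun k => (ν k : Measure E)))) :=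
  (Real.continuous_exp.tendsto _).comp (hasSum_integral_measure hint).tendsto_sum_nat

variable [Nonempty E] (ν : ℕ → FiniteMeasure E)

/-- Given the numbers of points, the positions are independent, so the inner integral is a product
of powers; the numbers of points are then independent across blocks. -/
theorem lintegral_prod_prod {F : E → ℝ≥0∞} (hF : Measurable F) (K : ℕ) :
    ∫⁻ a, ∏ k ∈ Finset.range K, ∏ i ∈ Finset.range (a.1 k), F (a.2 (k, i)) ∂law ν
      = ∏ k ∈ Finset.range K, ∫⁻ n : ℕ, (∫⁻ x, F x ∂((ν k).normalize : Measure E)) ^ n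
          ∂poissonMeasure (ν k).mass := by
  have hmeas : Measurable fun a : Sample E =>
      ∏ k ∈ Finset.range K, ∏ i ∈ Finset.range (a.1 k), F (a.2 (k, i)) := by
    refine Finset.measurable_fun_prod _ fun k _ => ?_
    have h : Measurable fun z : ℕ × (ℕ × ℕ → E) => ∏ i ∈ Finset.range z.1, F (z.2 (k, i)) :=
      measurable_from_prod_countable_right fun n =>
        Finset.measurable_fun_prod (Finset.range n) fun i _ =>
          hF.comp (measurable_pi_apply (k, i))
    exact h.comp (f := fun a : Sample E => (a.1 k, a.2)) (by fun_prop)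
  rw [law, lintegral_prod _ hmeas.aemeasurable]
  have hinner : ∀ n : ℕ → ℕ,
      ∫⁻ x, ∏ k ∈ Finset.range K, ∏ i ∈ Finset.range (n k), F (x (k, i))
        ∂Measure.infinitePi (fun ι : ℕ × ℕ => ((ν ι.1).normalize : Measure E))
      = ∏ k ∈ Finset.range K, (∫⁻ x, F x ∂((ν k).normalize : Measure E)) ^ (n k) := by
    intro n
    let r : Finset (ℕ × ℕ) := ((Finset.range K).sigma fun k => Finset.range (n k)).map
      (Equiv.sigmaEquivProd ℕ ℕ).toEmbedding
    have hr : ∀ u : ℕ × ℕ → ℝ≥0∞, ∏ k ∈ Finset.range K, ∏ i ∈ Finset.range (n k), u (k, i)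
        = ∏ p ∈ r, u p := fun u =>
      (Finset.prod_finset_product r (Finset.range K) (fun k => Finset.range (n k)) (by
        rintro ⟨k, i⟩
        simp [r])).symm
    simp_rw [fun x : ℕ × ℕ → E => hr fun p => F (x p)]
    rw [lintegral_prod_eq_prod_lintegral_of_indepFun _ (fun ι (x : ℕ × ℕ → E) => F (x ι))
      (iIndepFun_infinitePi (X := fun _ => F) fun _ => hF)
      fun ι => hF.comp (measurable_pi_apply ι)]
    have heval : ∀ ι : ℕ × ℕ, ∫⁻ x, F (x ι)
        ∂Measure.infinitePi (fun ι : ℕ × ℕ => ((ν ι.1).normalize : Measure E))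
        = ∫⁻ x, F x ∂((ν ι.1).normalize : Measure E) := fun ι =>
      (measurePreserving_eval_infinitePi
        (fun ι : ℕ × ℕ => ((ν ι.1).normalize : Measure E)) ι).lintegral_comp hF
    simp_rw [heval]
    rw [← hr fun p => ∫⁻ x, F x ∂((ν p.1).normalize : Measure E)]
    simp
  simp_rw [hinner]
  rw [lintegral_prod_eq_prod_lintegral_of_indepFun _
    (fun k (n : ℕ → ℕ) => (∫⁻ x, F x ∂((ν k).normalize : Measure E)) ^ (n k))
    (iIndepFun_infinitePi (X := fun k n => (∫⁻ x, F x ∂((ν k).normalize : Measure E)) ^ n)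
      fun _ => Measurable.of_discrete)
    fun k => (Measurable.of_discrete (f := fun n : ℕ =>
      (∫⁻ x, F x ∂((ν k).normalize : Measure E)) ^ n)).comp (measurable_pi_apply k)]
  refine Finset.prod_congr rfl fun k _ => ?_
  exact (measurePreserving_eval_infinitePi (fun k => poissonMeasure (ν k).mass) k).lintegral_comp
    (f := fun n : ℕ => (∫⁻ x, F x ∂((ν k).normalize : Measure E)) ^ n) Measurable.of_discrete

theorem lintegral_exp_partialSum {g : E → ℝ} (hg : Measurable g) {C : ℝ} (hC : ∀ x, |g x| ≤ C)
    (K : ℕ) :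
    ∫⁻ a, ENNReal.ofReal (Real.exp (partialSum g K a)) ∂law ν
      = ENNReal.ofReal (Real.exp
        (∑ k ∈ Finset.range K, ∫ x, (Real.exp (g x) - 1) ∂(ν k : Measure E))) := by
  have h1 : ∀ a : Sample E, ENNReal.ofReal (Real.exp (partialSum g K a))
      = ∏ k ∈ Finset.range K, ∏ i ∈ Finset.range (a.1 k),
        ENNReal.ofReal (Real.exp (g (a.2 (k, i)))) := by
    intro a
    simp_rw [partialSum, Real.exp_sum]
    rw [ENNReal.ofReal_prod_of_nonneg fun _ _ => by positivity]
    refine Finset.prod_congr rfl fun k _ => ?_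
    rw [ENNReal.ofReal_prod_of_nonneg fun _ _ => by positivity]
  simp_rw [h1]
  rw [lintegral_prod_prod ν (F := fun x => ENNReal.ofReal (Real.exp (g x))) (by fun_prop),
    Real.exp_sum, ENNReal.ofReal_prod_of_nonneg fun _ _ => by positivity]
  refine Finset.prod_congr rfl fun k _ => ?_
  have h2 : ∀ (μ : Measure E) [IsFiniteMeasure μ],
      ∫⁻ x, ENNReal.ofReal (Real.exp (g x)) ∂μ = ENNReal.ofReal (∫ x, Real.exp (g x) ∂μ) :=
    fun μ _ => (ofReal_integral_eq_lintegral_ofReal (integrable_exp_of_bounded hg hC)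
      (Eventually.of_forall fun x => (Real.exp_pos _).le)).symm
  have h3 := lintegral_eq_mass_mul_normalize (ν k) fun x => ENNReal.ofReal (Real.exp (g x))
  have h0 : 0 ≤ ∫ x, Real.exp (g x) ∂((ν k).normalize : Measure E) :=
    integral_nonneg fun x => (Real.exp_pos _).le
  have h4 : ∫ x, Real.exp (g x) ∂(ν k : Measure E)
      = (ν k).mass * ∫ x, Real.exp (g x) ∂((ν k).normalize : Measure E) := by
    rw [h2, h2, ← ENNReal.ofReal_coe_nnreal, ← ENNReal.ofReal_mul (by positivity)] at h3
    exact (ENNReal.ofReal_eq_ofReal_iff (integral_nonneg fun x => (Real.exp_pos _).le)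
      (by positivity)).1 h3
  rw [h2, ENNReal.ofReal, lintegral_pow_poissonMeasure,
    integral_sub (integrable_exp_of_bounded hg hC) (integrable_const _), h4,
    Real.coe_toNNReal _ h0]
  congr 3
  rw [integral_const, smul_eq_mul, mul_one]
  rfl

theorem ae_integrable_points {g : E → ℝ} (hg : Measurable g)
    (hint : Integrable g (Measure.sum fun k => (ν k : Measure E))) :
    ∀ᵐ a ∂law ν, Integrable g (points a) := by
  have h := lintegral_lintegral_points ν (G := fun x => ‖g x‖ₑ) (by fun_prop)
  have hm : Measurable fun a : Sample E => ∫⁻ x, ‖g x‖ₑ ∂points a :=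
    (measurable_lintegral_points (β := Unit) (G := fun _ x => ‖g x‖ₑ)
      (hg.enorm.comp measurable_snd)).comp
      (f := fun a : Sample E => (a, ())) (measurable_id.prodMk measurable_const)
  filter_upwards [ae_lt_top hm (by rw [h]; exact hint.2.ne)] with a ha
  exact ⟨hg.aestronglyMeasurable, ha⟩

/-- Fatou's lemma along the partial sums, whose exponential moments are explicit and converge. This
provides the dominating function for the Laplace functional. -/
theorem lintegral_exp_integral_abs_lt_top {g : E → ℝ} (hg : Measurable g) {C : ℝ}
    (hC : ∀ x, |g x| ≤ C) (hint : Integrable g (Measure.sum fun k => (ν k : Measure E))) :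
    ∫⁻ a, ENNReal.ofReal (Real.exp (∫ x, |g x| ∂points a)) ∂law ν < ∞ := by
  have hga : Measurable fun x => |g x| := by fun_prop
  have hCa : ∀ x, |(|g x|)| ≤ C := fun x => by rw [abs_abs]; exact hC x
  have hlim : ∀ᵐ a ∂law ν, ENNReal.ofReal (Real.exp (∫ x, |g x| ∂points a))
      = liminf (fun K => ENNReal.ofReal (Real.exp (partialSum (fun x => |g x|) K a))) atTop := by
    filter_upwards [ae_integrable_points ν hg hint] with a ha
    exact ((ENNReal.tendsto_ofReal ((Real.continuous_exp.tendsto _).comp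
      (tendsto_partialSum hga ha.abs))).liminf_eq).symm
  rw [lintegral_congr_ae hlim]
  refine lt_of_le_of_lt (lintegral_liminf_le fun K =>
    (Real.measurable_exp.comp (measurable_partialSum hga K)).ennreal_ofReal) ?_
  simp_rw [lintegral_exp_partialSum ν hga hCa]
  rw [(ENNReal.tendsto_ofReal (tendsto_exp_sum_integral ν
    (integrable_exp_sub_one hga hCa hint.abs))).liminf_eq]
  exact ENNReal.ofReal_lt_top

/-- The Laplace functional of the Poisson process. -/
theorem integrable_exp_and_integral_exp {g : E → ℝ} (hg : Measurable g) {C : ℝ}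
    (hC : ∀ x, |g x| ≤ C) (hint : Integrable g (Measure.sum fun k => (ν k : Measure E))) :
    Integrable (fun a => Real.exp (∫ x, g x ∂points a)) (law ν) ∧
      ∫ a, Real.exp (∫ x, g x ∂points a) ∂law ν
        = Real.exp (∫ x, (Real.exp (g x) - 1) ∂Measure.sum fun k => (ν k : Measure E)) := by
  have hae := ae_integrable_points ν hg hint
  have hmS : ∀ K, AEStronglyMeasurable (fun a => Real.exp (partialSum g K a)) (law ν) :=
    fun K => (Real.measurable_exp.comp (measurable_partialSum hg K)).aestronglyMeasurable
  have hlim : ∀ᵐ a ∂law ν, Tendsto (fun K => Real.exp (partialSum g K a)) atTop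
      (𝓝 (Real.exp (∫ x, g x ∂points a))) := by
    filter_upwards [hae] with a ha
    exact (Real.continuous_exp.tendsto _).comp (tendsto_partialSum hg ha)
  have hbound : Integrable (fun a => Real.exp (∫ x, |g x| ∂points a)) (law ν) := by
    refine ⟨aestronglyMeasurable_of_tendsto_ae atTop
      (f := fun K a => Real.exp (partialSum (fun x => |g x|) K a))
      (fun K => (Real.measurable_exp.comp
        (measurable_partialSum (by fun_prop) K)).aestronglyMeasurable) ?_, ?_⟩
    · filter_upwards [hae] with a ha
      exact (Real.continuous_exp.tendsto _).comp (tendsto_partialSum (by fun_prop) ha.abs)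
    · rw [hasFiniteIntegral_iff_ofReal (Eventually.of_forall fun _ => (Real.exp_pos _).le)]
      exact lintegral_exp_integral_abs_lt_top ν hg hC hint
  have hdom : ∀ K, ∀ᵐ a ∂law ν,
      ‖Real.exp (partialSum g K a)‖ ≤ Real.exp (∫ x, |g x| ∂points a) := by
    intro K
    filter_upwards [hae] with a ha
    rw [Real.norm_eq_abs, Real.abs_exp]
    exact Real.exp_le_exp.2 ((le_abs_self _).trans (abs_partialSum_le hg ha K))
  refine ⟨hbound.mono (aestronglyMeasurable_of_tendsto_ae atTop hmS hlim) ?_, ?_⟩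
  · filter_upwards [hae] with a ha
    rw [Real.norm_eq_abs, Real.norm_eq_abs, Real.abs_exp, Real.abs_exp]
    exact Real.exp_le_exp.2 (integral_mono ha ha.abs fun x => le_abs_self _)
  · have h1 := tendsto_integral_of_dominated_convergence _ hmS hbound hdom hlim
    refine tendsto_nhds_unique h1 ?_
    refine (tendsto_exp_sum_integral ν (integrable_exp_sub_one hg hC hint)).congr fun K => ?_
    rw [integral_eq_lintegral_of_nonneg_ae (Eventually.of_forall fun _ => (Real.exp_pos _).le)
      (hmS K), lintegral_exp_partialSum ν hg hC, ENNReal.toReal_ofReal (Real.exp_pos _).le]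

end PoissonProcess

end PoissonProcessLaplace

/-! ### Projecting the points of a region to a configuration -/

section Configuration

open Filter Topology ProbabilityTheory

namespace PoissonProcess

section ActiveIn

variable {E : Type*}

/-- The indices of the points of an outcome which lie in `S`. -/
def activeIn (a : Sample E) (S : Set E) : Set (ℕ × ℕ) := {ι | ι.2 < a.1 ι.1 ∧ a.2 ι ∈ S}

theorem points_apply [MeasurableSpace E] (a : Sample E) {S : Set E} (hS : MeasurableSet S) :
    points a S = ((activeIn a S).encard : ℝ≥0∞) := by
  rw [← lintegral_indicator_one hS, lintegral_points a (by fun_prop (disch := exact hS)),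
    ← ENNReal.tsum_set_one, tsum_subtype (activeIn a S) fun _ => (1 : ℝ≥0∞)]
  refine tsum_congr fun ι => ?_
  by_cases h1 : ι.2 < a.1 ι.1 <;> by_cases h2 : a.2 ι ∈ S <;>
    simp [activeIn, h1, h2]

theorem measurable_points [MeasurableSpace E] {β : Type*} [MeasurableSpace β] {V : Set (β × E)}
    (hV : MeasurableSet V) : Measurable fun z : Sample E × β => points z.1 (Prod.mk z.2 ⁻¹' V) := by
  have h := measurable_lintegral_points (β := β) (E := E)
    (G := fun b x => V.indicator 1 (b, x)) (measurable_one.indicator hV)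
  convert h using 2 with z
  rw [← lintegral_indicator_one (measurable_prodMk_left hV)]
  rfl

end ActiveIn

variable {Λ : Type*} [MetricSpace Λ] [SigmaCompactSpace Λ] [LocallyCompactSpace Λ]

/-- The points of the outcome which lie in `U` have distinct projections to `Λ`, finitely many of
which lie in a compact set. -/
structure IsSimpleIn (a : Sample (Λ × ℝ)) (U : Set (Λ × ℝ)) : Prop where
  finite : ∀ n, (activeIn a (U ∩ Prod.fst ⁻¹' CompactExhaustion.choice Λ n)).Finite
  injective : ∀ ι ι' : ℕ × ℕ, ι.2 < a.1 ι.1 → ι'.2 < a.1 ι'.1 →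
    (a.2 ι).1 = (a.2 ι').1 → ι = ι'

open Classical in
/-- The projection to `Λ` of the points of an outcome which lie in `U`. -/
noncomputable def config (a : Sample (Λ × ℝ)) (U : Set (Λ × ℝ)) : ConfigSpace Λ :=
  if h : IsSimpleIn a U then
    { carrier := (fun ι => (a.2 ι).1) '' activeIn a U
      finite_inter := fun K hK => by
        obtain ⟨n, hn⟩ := (CompactExhaustion.choice Λ).exists_superset_of_isCompact hK
        refine ((h.finite n).image fun ι => (a.2 ι).1).subset ?_
        rintro _ ⟨⟨ι, hι, rfl⟩, hιK⟩
        exact ⟨ι, ⟨hι.1, hι.2, hn hιK⟩, rfl⟩ }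
  else ⟨∅, fun K _ => by simp⟩

theorem carrier_config {a : Sample (Λ × ℝ)} {U : Set (Λ × ℝ)} (h : IsSimpleIn a U) :
    (config a U).carrier = (fun ι => (a.2 ι).1) '' activeIn a U := by
  rw [config, dif_pos h]

/-- A site occupied through `U` but not through `V` is the projection of a point of `U` outside `V`.
-/
theorem totalVariationDist_config_le {a : Sample (Λ × ℝ)} {U V : Set (Λ × ℝ)}
    (hU : IsSimpleIn a U) (hV : IsSimpleIn a V) :
    totalVariationDist (config a U) (config a V)
      ≤ ((activeIn a (U \ V)).encard : ℝ≥0∞) + ((activeIn a (V \ U)).encard : ℝ≥0∞) := by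
  have h : ∀ {U V : Set (Λ × ℝ)}, IsSimpleIn a U → IsSimpleIn a V →
      ((config a U).carrier \ (config a V).carrier).encard ≤ (activeIn a (U \ V)).encard := by
    intro U V hU hV
    refine le_trans (Set.encard_le_encard ?_) (Set.encard_image_le (fun ι => (a.2 ι).1) _)
    rw [carrier_config hU, carrier_config hV]
    rintro _ ⟨⟨ι, hι, rfl⟩, hιV⟩
    exact ⟨ι, ⟨hι.1, hι.2, fun h => hιV ⟨ι, ⟨hι.1, h⟩, rfl⟩⟩, rfl⟩
  rw [totalVariationDist, ENat.toENNReal_add]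
  exact add_le_add (ENat.toENNReal_mono (h hU hV)) (ENat.toENNReal_mono (h hV hU))

variable [MeasurableSpace Λ]

theorem toMeasure_config_apply {a : Sample (Λ × ℝ)} {U : Set (Λ × ℝ)} (hU : MeasurableSet U)
    (h : IsSimpleIn a U) {s : Set Λ} (hs : MeasurableSet s) :
    (config a U).toMeasure s = points a (U ∩ Prod.fst ⁻¹' s) := by
  rw [ConfigSpace.toMeasure_apply _ hs, points_apply a (hU.inter (measurable_fst hs)),
    carrier_config h]
  have h1 : (fun ι => (a.2 ι).1) '' activeIn a U ∩ s
      = (fun ι => (a.2 ι).1) '' activeIn a (U ∩ Prod.fst ⁻¹' s) := by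
    ext x
    constructor
    · rintro ⟨⟨ι, hι, rfl⟩, hx⟩
      exact ⟨ι, ⟨hι.1, hι.2, hx⟩, rfl⟩
    · rintro ⟨ι, hι, rfl⟩
      exact ⟨⟨ι, ⟨hι.1, hι.2.1⟩, rfl⟩, hι.2.2⟩
  rw [h1, Set.InjOn.encard_image]
  exact fun ι hι ι' hι' heq => h.injective ι ι' hι.1 hι'.1 heq

theorem toMeasure_config {a : Sample (Λ × ℝ)} {U : Set (Λ × ℝ)} (hU : MeasurableSet U)
    (h : IsSimpleIn a U) : (config a U).toMeasure = ((points a).restrict U).map Prod.fst := by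
  ext s hs
  rw [toMeasure_config_apply hU h hs, Measure.map_apply measurable_fst hs,
    Measure.restrict_apply (measurable_fst hs), Set.inter_comm]

theorem toMeasure_config_of_not {a : Sample (Λ × ℝ)} {U : Set (Λ × ℝ)} (h : ¬ IsSimpleIn a U) :
    (config a U).toMeasure = 0 := by
  ext s hs
  rw [ConfigSpace.toMeasure_apply _ hs, config, dif_neg h]
  simp

variable [BorelSpace Λ]

/-- Finiteness becomes a bound on the mass of `points`, leaving countably many conditions, each
measurable in the outcome and in a parameter on which `U` depends. -/
theorem isSimpleIn_iff {a : Sample (Λ × ℝ)} {U : Set (Λ × ℝ)} (hU : MeasurableSet U) :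
    IsSimpleIn a U ↔ (∀ n, points a (U ∩ Prod.fst ⁻¹' CompactExhaustion.choice Λ n) < ∞) ∧
      ∀ ι ι' : ℕ × ℕ, ι.2 < a.1 ι.1 → ι'.2 < a.1 ι'.1 → (a.2 ι).1 = (a.2 ι').1 → ι = ι' := by
  have h : ∀ n, points a (U ∩ Prod.fst ⁻¹' CompactExhaustion.choice Λ n) < ∞ ↔
      (activeIn a (U ∩ Prod.fst ⁻¹' CompactExhaustion.choice Λ n)).Finite := by
    intro n
    rw [points_apply a (hU.inter (measurable_fst
      ((CompactExhaustion.choice Λ).isCompact n).measurableSet)), ENat.toENNReal_lt_top,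
      Set.encard_lt_top_iff]
  simp_rw [h]
  exact ⟨fun h => ⟨h.1, h.2⟩, fun h => ⟨h.1, h.2⟩⟩

variable {β : Type*} [MeasurableSpace β] {V : Set (β × (Λ × ℝ))}

theorem measurableSet_isSimpleIn (hV : MeasurableSet V) :
    MeasurableSet {z : Sample (Λ × ℝ) × β | IsSimpleIn z.1 (Prod.mk z.2 ⁻¹' V)} := by
  have : SecondCountableTopology Λ := EMetric.secondCountable_of_sigmaCompact Λ
  simp_rw [fun z : Sample (Λ × ℝ) × β => isSimpleIn_iff (a := z.1) (measurable_prodMk_left hV)]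
  simp only [Set.ofPred_and, Set.ofPred_forall]
  refine MeasurableSet.inter (MeasurableSet.iInter fun n => ?_) ?_
  · refine measurableSet_lt (measurable_points (V := V ∩ (fun z => z.2.1) ⁻¹'
      CompactExhaustion.choice Λ n) (hV.inter ?_)) measurable_const
    exact (measurable_fst.comp measurable_snd)
      ((CompactExhaustion.choice Λ).isCompact n).measurableSet
  · refine MeasurableSet.iInter fun ι => MeasurableSet.iInter fun ι' => ?_
    simp only [imp_iff_not_or, Set.ofPred_or]
    refine ((measurable_fst (measurableSet_active ι)).compl).union
      (((measurable_fst (measurableSet_active ι')).compl).union (MeasurableSet.union ?_ ?_))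
    · exact (measurableSet_eq_fun (by fun_prop) (by fun_prop)).compl
    · exact MeasurableSet.const _

theorem measurable_config (hV : MeasurableSet V) :
    Measurable fun z : Sample (Λ × ℝ) × β => config z.1 (Prod.mk z.2 ⁻¹' V) := by
  classical
  refine ConfigSpace.measurable_of_measurable_toMeasure fun s hs => ?_
  have h : ∀ z : Sample (Λ × ℝ) × β, (config z.1 (Prod.mk z.2 ⁻¹' V)).toMeasure s
      = if IsSimpleIn z.1 (Prod.mk z.2 ⁻¹' V) then
        points z.1 (Prod.mk z.2 ⁻¹' (V ∩ (fun z => z.2.1) ⁻¹' s)) else 0 := by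
    intro z
    split_ifs with hz
    · exact toMeasure_config_apply (measurable_prodMk_left hV) hz hs
    · rw [toMeasure_config_of_not hz]
      rfl
  simp_rw [h]
  exact Measurable.ite (measurableSet_isSimpleIn hV)
    (measurable_points (hV.inter ((measurable_fst.comp measurable_snd) hs))) measurable_const

theorem measurable_config_left {U : Set (Λ × ℝ)} (hU : MeasurableSet U) :
    Measurable fun a : Sample (Λ × ℝ) => config a U :=
  (measurable_config (β := Unit) (V := Prod.snd ⁻¹' U) (measurable_snd hU)).comp
    (f := fun a : Sample (Λ × ℝ) => (a, ())) (measurable_id.prodMk measurable_const)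

variable [Nonempty (Λ × ℝ)] {ν : ℕ → FiniteMeasure (Λ × ℝ)} {U : Set (Λ × ℝ)} {m : Measure Λ}

/-- By Campbell's formula the mean number of points over a compact set is its `m`-measure, hence
finite. The default value in `config` thus occurs only on a null set. -/
theorem ae_isSimpleIn [IsFiniteMeasureOnCompacts m] (hU : MeasurableSet U)
    (hm : ((Measure.sum fun k => (ν k : Measure (Λ × ℝ))).restrict U).map Prod.fst = m)
    (h0 : ∀ k x, (ν k : Measure (Λ × ℝ)) (Prod.fst ⁻¹' {x}) = 0) :
    ∀ᵐ a ∂law ν, IsSimpleIn a U := by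
  have : SecondCountableTopology Λ := EMetric.secondCountable_of_sigmaCompact Λ
  simp_rw [fun a : Sample (Λ × ℝ) => isSimpleIn_iff (a := a) hU]
  refine Filter.Eventually.and ?_ (ae_projection_injective ν measurable_fst h0)
  rw [ae_all_iff]
  intro n
  have hK := (CompactExhaustion.choice Λ).isCompact n
  have hS : MeasurableSet (U ∩ Prod.fst ⁻¹' CompactExhaustion.choice Λ n) :=
    hU.inter (measurable_fst hK.measurableSet)
  have h1 := lintegral_lintegral_points ν (measurable_one.indicator hS)
  simp_rw [lintegral_indicator_one hS] at h1
  rw [Set.inter_comm, ← Measure.restrict_apply (measurable_fst hK.measurableSet),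
    ← Measure.map_apply measurable_fst hK.measurableSet, hm, Set.inter_comm] at h1
  refine ae_lt_top ?_ (by rw [h1]; exact hK.measure_lt_top.ne)
  exact (measurable_points (β := Unit) (measurable_snd hS)).comp
    (f := fun a : Sample (Λ × ℝ) => (a, ())) (measurable_id.prodMk measurable_const)

/-- Apply the Laplace functional to `f ∘ Prod.fst` cut off outside `U`: there `e^g - 1` vanishes, so
the exponent is an integral over `U`, whose projection is `m`. -/
theorem isPoissonLaw_map_config [IsFiniteMeasureOnCompacts m] (hU : MeasurableSet U)
    (hm : ((Measure.sum fun k => (ν k : Measure (Λ × ℝ))).restrict U).map Prod.fst = m)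
    (h0 : ∀ k x, (ν k : Measure (Λ × ℝ)) (Prod.fst ⁻¹' {x}) = 0) :
    IsPoissonLaw m ((law ν).map fun a => config a U) := by
  have hc := measurable_config_left hU
  have key : ∀ f : C_c(Λ, ℝ),
      Integrable (fun a => Real.exp (∫ x, f x ∂(config a U).toMeasure)) (law ν) ∧
      ∫ a, Real.exp (∫ x, f x ∂(config a U).toMeasure) ∂law ν
        = Real.exp (∫ x, (Real.exp (f x) - 1) ∂m) := by
    intro f
    have hf : Measurable f := f.continuous.measurable
    obtain ⟨C, hC⟩ := f.hasCompactSupport.exists_bound_of_continuous f.continuous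
    have hC0 : ∀ x : Λ × ℝ, |U.indicator (fun z => f z.1) x| ≤ max C 0 := by
      intro x
      by_cases hx : x ∈ U
      · rw [Set.indicator_of_mem hx]
        exact (hC x.1).trans (le_max_left _ _)
      · rw [Set.indicator_of_notMem hx, abs_zero]
        exact le_max_right _ _
    have hint : Integrable (U.indicator fun z => f z.1)
        (Measure.sum fun k => (ν k : Measure (Λ × ℝ))) := by
      rw [integrable_indicator_iff hU]
      have h1 : Integrable f m := f.continuous.integrable_of_hasCompactSupport f.hasCompactSupport
      rw [← hm, integrable_map_measure hf.aestronglyMeasurable measurable_fst.aemeasurable] at h1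
      exact h1
    obtain ⟨h1, h2⟩ := integrable_exp_and_integral_exp ν
      ((hf.comp measurable_fst).indicator hU) hC0 hint
    have h3 : (fun a => Real.exp (∫ x, f x ∂(config a U).toMeasure)) =ᵐ[law ν]
        fun a => Real.exp (∫ x, U.indicator (f ∘ Prod.fst) x ∂points a) := by
      filter_upwards [ae_isSimpleIn hU hm h0] with a ha
      rw [toMeasure_config hU ha, integral_map measurable_fst.aemeasurable
        hf.aestronglyMeasurable, integral_indicator hU]
      rfl
    refine ⟨h1.congr h3.symm, ?_⟩
    rw [integral_congr_ae h3, h2, ← hm, integral_map measurable_fst.aemeasurable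
      (by fun_prop), ← integral_indicator hU]
    congr 2
    ext x
    by_cases hx : x ∈ U <;> simp [hx]
  have hexp : ∀ f : C_c(Λ, ℝ), AEStronglyMeasurable
      (fun ω : ConfigSpace Λ => Real.exp (∫ x, f x ∂ω.toMeasure))
      ((law ν).map fun a => config a U) := fun f => (Real.measurable_exp.comp
    (ConfigSpace.measurable_integral f)).aestronglyMeasurable
  refine ⟨Measure.isProbabilityMeasure_map hc.aemeasurable, fun f => ?_, fun f => ?_⟩
  · exact (integrable_map_measure (hexp f) hc.aemeasurable).2 (key f).1
  · rw [integral_map hc.aemeasurable (hexp f)]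
    exact (key f).2

end PoissonProcess

end Configuration

/-! ### Couplings realized on a common probability space -/

section Coupling

open Filter Topology ProbabilityTheory

variable {Λ : Type*}

theorem independentLaw_eq_map [TopologicalSpace Λ] [MeasurableSpace Λ] {Ω : Type*}
    [MeasurableSpace Ω] {Q : Measure Ω} [IsProbabilityMeasure Q]
    {σ : DiffuseRadonMeasure Λ} {P : Measure (DiffuseRadonMeasure Λ)} [IsProbabilityMeasure P]
    {N : Ω → ConfigSpace Λ} (hN : Measurable N) (h : poissonLaw σ = Q.map N) :
    independentLaw σ P = (Q.prod P).map fun z => (N z.1, z.2) := by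
  have h1 := Measure.map_prod_map Q P hN (measurable_id (α := DiffuseRadonMeasure Λ))
  rw [Measure.map_id] at h1
  rw [independentLaw, h, h1]
  rfl

/-- Being a choice for each `m`, `poissonLaw m` is not visibly measurable in `m`. It is replaced
almost everywhere by the image of `Q`, which is a measurable kernel because `N` is jointly
measurable. -/
theorem coxLaw_eq_map [TopologicalSpace Λ] [MeasurableSpace Λ] {Ω : Type*}
    [MeasurableSpace Ω] {Q : Measure Ω} [IsProbabilityMeasure Q]
    {P : Measure (DiffuseRadonMeasure Λ)} [IsProbabilityMeasure P]
    {N : Ω × DiffuseRadonMeasure Λ → ConfigSpace Λ} (hN : Measurable N)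
    (h : ∀ᵐ m ∂P, poissonLaw m = Q.map fun a => N (a, m)) :
    coxLaw P = (Q.prod P).map fun z => (N z, z.2) := by
  have hT : Measurable fun z : Ω × DiffuseRadonMeasure Λ => (N z, z.2) := hN.prodMk measurable_snd
  have hae : (fun m => (poissonLaw m).map fun ω => (ω, m))
      =ᵐ[P] fun m => Q.map fun a => (N (a, m), m) := by
    filter_upwards [h] with m hm
    have hNm : Measurable fun a => N (a, m) := hN.comp measurable_prodMk_right
    rw [hm, Measure.map_map measurable_prodMk_right hNm, Function.comp_def]
  have happ : ∀ m s, MeasurableSet s → Q.map (fun a => (N (a, m), m)) s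
      = Q ((fun a => (a, m)) ⁻¹' ((fun z => (N z, z.2)) ⁻¹' s)) := fun m s hs =>
    Measure.map_apply (hT.comp measurable_prodMk_right) hs
  have hker : Measurable fun m => Q.map fun a => (N (a, m), m) := by
    refine Measure.measurable_of_measurable_coe _ fun s hs => ?_
    simp_rw [happ _ s hs]
    exact measurable_measure_prodMk_right (hT hs)
  rw [coxLaw, Measure.bind_congr_right hae]
  ext s hs
  rw [Measure.bind_apply hs hker.aemeasurable, Measure.map_apply hT hs,
    Measure.prod_apply_symm (hT hs)]
  exact lintegral_congr fun m => happ m s hs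

/-- A Poisson process and a Cox process on the same probability space give an upper bound of the
Rubinstein distance. -/
theorem rubinsteinDist_le_of_coupling [TopologicalSpace Λ] [MeasurableSpace Λ] {Ω : Type*}
    [MeasurableSpace Ω] {Q : Measure Ω} [IsProbabilityMeasure Q]
    {σ : DiffuseRadonMeasure Λ} {P : Measure (DiffuseRadonMeasure Λ)} [IsProbabilityMeasure P]
    {N₀ : Ω → ConfigSpace Λ} (hN₀ : Measurable N₀) (h₀ : poissonLaw σ = Q.map N₀)
    {N : Ω × DiffuseRadonMeasure Λ → ConfigSpace Λ} (hN : Measurable N)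
    (h : ∀ᵐ m ∂P, poissonLaw m = Q.map fun a => N (a, m)) :
    rubinsteinDist
        (fun z w : ConfigSpace Λ × DiffuseRadonMeasure Λ => totalVariationDist z.1 w.1)
        (independentLaw σ P) (coxLaw P)
      ≤ ∫⁻ z, totalVariationDist (N₀ z.1) (N z) ∂Q.prod P := by
  have h1 : Measurable fun z : Ω × DiffuseRadonMeasure Λ => (N₀ z.1, z.2) :=
    (hN₀.comp measurable_fst).prodMk measurable_snd
  have h2 : Measurable fun z : Ω × DiffuseRadonMeasure Λ => (N z, z.2) := hN.prodMk measurable_snd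
  let γ := (Q.prod P).map fun z => ((N₀ z.1, z.2), (N z, z.2))
  have hγ : IsProbabilityMeasure γ := Measure.isProbabilityMeasure_map (h1.prodMk h2).aemeasurable
  have hγ₁ : γ.map Prod.fst = independentLaw σ P := by
    rw [Measure.map_map measurable_fst (h1.prodMk h2), independentLaw_eq_map hN₀ h₀,
      Function.comp_def]
  have hγ₂ : γ.map Prod.snd = coxLaw P := by
    rw [Measure.map_map measurable_snd (h1.prodMk h2), coxLaw_eq_map hN h, Function.comp_def]
  -- For an image measure this inequality needs no measurability of the cost.
  exact (iInf₂_le γ ⟨hγ, hγ₁, hγ₂⟩).trans (lintegral_map_le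
    (fun w : (ConfigSpace Λ × DiffuseRadonMeasure Λ) × (ConfigSpace Λ × DiffuseRadonMeasure Λ) =>
      totalVariationDist w.1.1 w.2.1) _)

end Coupling

/-! ### Regions below graphs and their areas -/

section Subgraph

open PoissonProcess

variable {Λ : Type*} [MeasurableSpace Λ]

/-- The points between the horizontal axis and the graph of `q`. -/
def subgraph (q : Λ → ℝ) : Set (Λ × ℝ) := {z | 0 < z.2 ∧ z.2 ≤ q z.1}

theorem measurableSet_subgraph {q : Λ → ℝ} (hq : Measurable q) : MeasurableSet (subgraph q) :=
  (measurableSet_lt measurable_const measurable_snd).inter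
    (measurableSet_le measurable_snd (hq.comp measurable_fst))

theorem map_fst_restrict_subgraph (σ : Measure Λ) [SFinite σ] {q : Λ → ℝ} (hq : Measurable q) :
    ((σ.prod volume).restrict (subgraph q)).map Prod.fst
      = σ.withDensity fun x => ENNReal.ofReal (q x) := by
  ext s hs
  have hU := measurableSet_subgraph hq
  rw [Measure.map_apply measurable_fst hs, Measure.restrict_apply (measurable_fst hs),
    Measure.prod_apply ((measurable_fst hs).inter hU), withDensity_apply _ hs,
    ← lintegral_indicator hs]
  refine lintegral_congr fun x => ?_
  by_cases hx : x ∈ s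
  · rw [Set.indicator_of_mem hx]
    have : Prod.mk x ⁻¹' (Prod.fst ⁻¹' s ∩ subgraph q) = Set.Ioc 0 (q x) := by
      ext y
      simp [subgraph, hx]
    rw [this, Real.volume_Ioc, sub_zero]
  · rw [Set.indicator_of_notMem hx]
    have : Prod.mk x ⁻¹' (Prod.fst ⁻¹' s ∩ subgraph q) = ∅ := by
      ext y
      simp [hx]
    rw [this, measure_empty]

/-- The vertical sections have lengths at most the positive parts of `r - q` and `q - r`, one of
which is zero. Equality can fail where a function is negative, as the region is then empty. -/
theorem prod_subgraph_diff_add_le (σ : Measure Λ) [SFinite σ] {q r : Λ → ℝ} (hq : Measurable q)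
    (hr : Measurable r) :
    (σ.prod volume) (subgraph r \ subgraph q) + (σ.prod volume) (subgraph q \ subgraph r)
      ≤ ∫⁻ x, ENNReal.ofReal |q x - r x| ∂σ := by
  have hU := measurableSet_subgraph hq
  have hV := measurableSet_subgraph hr
  have h : ∀ {q r : Λ → ℝ} (x : Λ), volume (Prod.mk x ⁻¹' (subgraph q \ subgraph r))
      ≤ ENNReal.ofReal (q x - r x) := by
    intro q r x
    rw [← Real.volume_Ioc]
    refine measure_mono ?_
    rintro y ⟨⟨h1, h2⟩, h3⟩
    exact ⟨not_le.1 fun h => h3 ⟨h1, h⟩, h2⟩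
  rw [Measure.prod_apply (hV.diff hU), Measure.prod_apply (hU.diff hV),
    ← lintegral_add_left (measurable_measure_prodMk_left (hV.diff hU))]
  refine lintegral_mono fun x => (add_le_add (h x) (h x)).trans ?_
  rcases le_total (q x) (r x) with hx | hx
  · rw [ENNReal.ofReal_of_nonpos (sub_nonpos.2 hx), add_zero, abs_sub_comm]
    exact ENNReal.ofReal_le_ofReal (le_abs_self _)
  · rw [ENNReal.ofReal_of_nonpos (sub_nonpos.2 hx), zero_add]
    exact ENNReal.ofReal_le_ofReal (le_abs_self _)

/-- Finite measures whose sum is the product of `σ` and the Lebesgue measure. -/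
noncomputable def intensitySeq (σ : Measure Λ) [SFinite σ] (k : ℕ) : FiniteMeasure (Λ × ℝ) :=
  ⟨sfiniteSeq (σ.prod volume) k, inferInstance⟩

theorem sum_intensitySeq (σ : Measure Λ) [SFinite σ] :
    (Measure.sum fun k => (intensitySeq σ k : Measure (Λ × ℝ))) = σ.prod volume :=
  sum_sfiniteSeq _

theorem map_fst_restrict_subgraph_intensitySeq (σ : Measure Λ) [SFinite σ] {q : Λ → ℝ}
    (hq : Measurable q) :
    ((Measure.sum fun k => (intensitySeq σ k : Measure (Λ × ℝ))).restrict (subgraph q)).map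
      Prod.fst = σ.withDensity fun x => ENNReal.ofReal (q x) := by
  rw [sum_intensitySeq, map_fst_restrict_subgraph σ hq]

theorem intensitySeq_fiber [MeasurableSingletonClass Λ] (σ : Measure Λ) [SFinite σ]
    [NullSingletonClass σ] (k : ℕ) (x : Λ) :
    (intensitySeq σ k : Measure (Λ × ℝ)) (Prod.fst ⁻¹' {x}) = 0 := by
  refine le_antisymm ((sfiniteSeq_le (σ.prod volume) k _).trans ?_) zero_le
  rw [← Set.prod_univ, Measure.prod_prod, measure_singleton, zero_mul]

end Subgraph

/-! ### The coupling bound and the theorem -/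

section Main

open Filter PoissonProcess

variable {Λ : Type*}

/-- The construction draws positions in `Λ × ℝ` and so needs a nonempty `Λ`; on an empty space all
integrals vanish. -/
theorem ConfigSpace.isPoissonLaw_dirac_of_isEmpty [TopologicalSpace Λ] [MeasurableSpace Λ]
    [IsEmpty Λ] (σ : Measure Λ)
    (ω : ConfigSpace Λ) : IsPoissonLaw σ (Measure.dirac ω) := by
  have h : ∀ (f : C_c(Λ, ℝ)) (ω : ConfigSpace Λ), ∫ x, f x ∂ω.toMeasure = 0 := fun f ω => by
    rw [Measure.eq_zero_of_isEmpty ω.toMeasure, integral_zero_measure]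
  refine ⟨inferInstance, fun f => ?_, fun f => ?_⟩
  · simp_rw [h]
    exact integrable_const _
  · simp_rw [h]
    simp [Measure.eq_zero_of_isEmpty σ]

theorem totalVariationDist_self [TopologicalSpace Λ] (ω : ConfigSpace Λ) : totalVariationDist ω ω = 0 := by
  simp [totalVariationDist]

variable [MetricSpace Λ] [SigmaCompactSpace Λ] [LocallyCompactSpace Λ]
  [MeasurableSpace Λ] [BorelSpace Λ]

theorem rubinsteinDist_le_of_isEmpty [IsEmpty Λ] (σ : DiffuseRadonMeasure Λ)
    (P : Measure (DiffuseRadonMeasure Λ)) [IsProbabilityMeasure P] :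
    rubinsteinDist
        (fun z w : ConfigSpace Λ × DiffuseRadonMeasure Λ => totalVariationDist z.1 w.1)
        (independentLaw σ P) (coxLaw P) ≤ 0 := by
  let ω : ConfigSpace Λ := ⟨∅, fun K _ => by simp⟩
  have h : ∀ m : DiffuseRadonMeasure Λ, poissonLaw m = Measure.dirac ω := fun m =>
    (ConfigSpace.isPoissonLaw_dirac_of_isEmpty m.toMeasure ω).poissonLaw_eq
  refine (rubinsteinDist_le_of_coupling (Q := Measure.dirac ω) (N₀ := id) (N := Prod.fst)
    measurable_id (by rw [h, Measure.map_id]) measurable_fst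
    (Eventually.of_forall fun m => ?_)).trans ?_
  · rw [h]
    exact Measure.map_id.symm
  · simp [totalVariationDist_self]

/-- If the intensity `m` has density `q` with respect to `σ`, the points below the graph of `q`
form a Poisson process of intensity `m`. -/
theorem poissonLaw_eq_map_config [Nonempty (Λ × ℝ)] (σ : Measure Λ) [SFinite σ]
    [NullSingletonClass σ] {m : DiffuseRadonMeasure Λ} {q : Λ → ℝ} (hq : Measurable q)
    (hm : σ.withDensity (fun x => ENNReal.ofReal (q x)) = m.toMeasure) :
    poissonLaw m = (law (intensitySeq σ)).map (fun a => config a (subgraph q)) ∧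
      ∀ᵐ a ∂law (intensitySeq σ), IsSimpleIn a (subgraph q) := by
  have := m.locallyFinite
  have h := (map_fst_restrict_subgraph_intensitySeq σ hq).trans hm
  exact ⟨(isPoissonLaw_map_config (measurableSet_subgraph hq) h (intensitySeq_fiber σ)).poissonLaw_eq,
    ae_isSimpleIn (measurableSet_subgraph hq) h (intensitySeq_fiber σ)⟩

theorem lintegral_points_apply {E : Type*} [MeasurableSpace E] [Nonempty E]
    (ν : ℕ → FiniteMeasure E) {S : Set E} (hS : MeasurableSet S) :
    ∫⁻ a, points a S ∂law ν = (Measure.sum fun k => (ν k : Measure E)) S := by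
  have h := lintegral_lintegral_points ν (measurable_one.indicator hS)
  simp_rw [lintegral_indicator_one hS] at h
  exact h

/-- By Tonelli the parameter `b` can be frozen; the two differences of regions are then
deterministic, and Campbell's formula gives their mean numbers of points. -/
theorem lintegral_totalVariationDist_config_le [Nonempty (Λ × ℝ)] (ν : ℕ → FiniteMeasure (Λ × ℝ))
    {β : Type*} [MeasurableSpace β] (P : Measure β) [IsProbabilityMeasure P]
    {U : Set (Λ × ℝ)} (hU : MeasurableSet U) {V : Set (β × (Λ × ℝ))} (hV : MeasurableSet V)
    (hsU : ∀ᵐ a ∂law ν, IsSimpleIn a U)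
    (hsV : ∀ᵐ b ∂P, ∀ᵐ a ∂law ν, IsSimpleIn a (Prod.mk b ⁻¹' V)) :
    ∫⁻ z, totalVariationDist (config z.1 U) (config z.1 (Prod.mk z.2 ⁻¹' V)) ∂(law ν).prod P
      ≤ ∫⁻ b, ((Measure.sum fun k => (ν k : Measure (Λ × ℝ))) (U \ Prod.mk b ⁻¹' V)
        + (Measure.sum fun k => (ν k : Measure (Λ × ℝ))) (Prod.mk b ⁻¹' V \ U)) ∂P := by
  have h1 : ∀ᵐ z ∂(law ν).prod P, IsSimpleIn z.1 (Prod.mk z.2 ⁻¹' V) := by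
    have h : ∀ᵐ z ∂P.prod (law ν), IsSimpleIn z.2 (Prod.mk z.1 ⁻¹' V) :=
      (Measure.ae_prod_iff_ae_ae
        (p := fun z : β × Sample (Λ × ℝ) => IsSimpleIn z.2 (Prod.mk z.1 ⁻¹' V))
        (measurable_swap (measurableSet_isSimpleIn hV))).2 hsV
    exact (Measure.measurePreserving_swap (μ := law ν) (ν := P)).quasiMeasurePreserving.ae h
  have hW₁ : MeasurableSet (Prod.snd ⁻¹' U \ V) := (measurable_snd hU).diff hV
  have hW₂ : MeasurableSet (V \ Prod.snd ⁻¹' U) := hV.diff (measurable_snd hU)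
  have hm₁ : Measurable fun z : Sample (Λ × ℝ) × β => points z.1 (U \ Prod.mk z.2 ⁻¹' V) :=
    measurable_points (V := Prod.snd ⁻¹' U \ V) hW₁
  have hm₂ : Measurable fun z : Sample (Λ × ℝ) × β => points z.1 (Prod.mk z.2 ⁻¹' V \ U) :=
    measurable_points (V := V \ Prod.snd ⁻¹' U) hW₂
  have hVb : ∀ b, MeasurableSet (Prod.mk b ⁻¹' V) := fun b => measurable_prodMk_left hV
  have h2 : ∀ᵐ z ∂(law ν).prod P,
      totalVariationDist (config z.1 U) (config z.1 (Prod.mk z.2 ⁻¹' V))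
        ≤ points z.1 (U \ Prod.mk z.2 ⁻¹' V) + points z.1 (Prod.mk z.2 ⁻¹' V \ U) := by
    filter_upwards [h1, measurePreserving_fst.quasiMeasurePreserving.ae hsU] with z hz hz'
    rw [points_apply _ (hU.diff (hVb z.2)), points_apply _ ((hVb z.2).diff hU)]
    exact totalVariationDist_config_le hz' hz
  refine (lintegral_mono_ae h2).trans ?_
  rw [lintegral_add_left hm₁, lintegral_prod_symm' _ hm₁, lintegral_prod_symm' _ hm₂,
    ← lintegral_add_left hm₁.lintegral_prod_left']
  refine lintegral_mono fun b => ?_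
  rw [lintegral_points_apply ν (hU.diff (hVb b)),
    lintegral_points_apply ν ((hVb b).diff hU)]

/-- Bound of the Rubinstein distance by the mean `L¹` distance of the density to `1`. -/
theorem rubinsteinDist_le_lintegral [Nonempty (Λ × ℝ)] (σ : DiffuseRadonMeasure Λ)
    (P : Measure (DiffuseRadonMeasure Λ)) [IsProbabilityMeasure P]
    {p : DiffuseRadonMeasure Λ → Λ → ℝ} (hp : Measurable (Function.uncurry p))
    (hd : ∀ᵐ m ∂P, σ.toMeasure.withDensity (fun x => ENNReal.ofReal (p m x)) = m.toMeasure) :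
    rubinsteinDist
        (fun z w : ConfigSpace Λ × DiffuseRadonMeasure Λ => totalVariationDist z.1 w.1)
        (independentLaw σ P) (coxLaw P)
      ≤ ∫⁻ m, ∫⁻ x, ENNReal.ofReal |p m x - 1| ∂σ.toMeasure ∂P := by
  have : SecondCountableTopology Λ := EMetric.secondCountable_of_sigmaCompact Λ
  have := σ.locallyFinite
  have := σ.diffuse
  have hU : MeasurableSet (subgraph fun _ : Λ => 1) := measurableSet_subgraph measurable_const
  obtain ⟨V, hVp⟩ : ∃ V : Set (DiffuseRadonMeasure Λ × (Λ × ℝ)),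
      V = {z | 0 < z.2.2 ∧ z.2.2 ≤ p z.1 z.2.1} := ⟨_, rfl⟩
  have hV : MeasurableSet V := by
    rw [hVp]
    exact (measurableSet_lt measurable_const (measurable_snd.comp measurable_snd)).inter
      (measurableSet_le (measurable_snd.comp measurable_snd)
        (hp.comp (measurable_fst.prodMk (measurable_fst.comp measurable_snd))))
  have hVm : ∀ m, Prod.mk m ⁻¹' V = subgraph (p m) := fun m => by rw [hVp]; rfl
  have hpm : ∀ m, Measurable (p m) := fun m => hp.comp measurable_prodMk_left
  obtain ⟨h1, h2⟩ := poissonLaw_eq_map_config σ.toMeasure (m := σ) (q := fun _ => 1)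
    measurable_const (by simp)
  have h3 : ∀ᵐ m ∂P,
      poissonLaw m = (law (intensitySeq σ.toMeasure)).map
        (fun a => config a (Prod.mk m ⁻¹' V)) ∧
      ∀ᵐ a ∂law (intensitySeq σ.toMeasure), IsSimpleIn a (Prod.mk m ⁻¹' V) := by
    filter_upwards [hd] with m hm
    rw [hVm]
    exact poissonLaw_eq_map_config σ.toMeasure (hpm m) hm
  refine (rubinsteinDist_le_of_coupling (measurable_config_left hU) h1
    (measurable_config hV) (h3.mono fun m hm => hm.1)).trans ?_
  refine (lintegral_totalVariationDist_config_le _ P hU hV h2 (h3.mono fun m hm => hm.2)).trans ?_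
  refine lintegral_mono fun m => ?_
  rw [hVm, sum_intensitySeq]
  exact prod_subgraph_diff_add_le σ.toMeasure (hpm m) measurable_const

theorem isProbabilityMeasure_poissonLaw (σ : DiffuseRadonMeasure Λ) :
    IsProbabilityMeasure (poissonLaw σ) := by
  have : SecondCountableTopology Λ := EMetric.secondCountable_of_sigmaCompact Λ
  have := σ.locallyFinite
  have := σ.diffuse
  rcases isEmpty_or_nonempty Λ with hΛ | hΛ
  · rw [(ConfigSpace.isPoissonLaw_dirac_of_isEmpty σ.toMeasure
      ⟨∅, fun K _ => by simp⟩).poissonLaw_eq]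
    infer_instance
  · rw [(poissonLaw_eq_map_config σ.toMeasure (m := σ) (q := fun _ => 1)
      measurable_const (by simp)).1]
    exact Measure.isProbabilityMeasure_map
      (measurable_config_left (measurableSet_subgraph measurable_const)).aemeasurable

/-- The property ignores the configuration, and the Poisson law is nonzero, so some section of the
product has it almost everywhere. -/
theorem ae_of_ae_independentLaw {σ : DiffuseRadonMeasure Λ} {P : Measure (DiffuseRadonMeasure Λ)}
    [IsProbabilityMeasure P] {r : DiffuseRadonMeasure Λ → Prop}
    (h : ∀ᵐ z ∂independentLaw σ P, r z.2) : ∀ᵐ m ∂P, r m := by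
  have := isProbabilityMeasure_poissonLaw σ
  obtain ⟨_, hω⟩ := (Measure.ae_ae_of_ae_prod h).exists
  exact hω

theorem lintegral_eq_ofReal_integral {σ : DiffuseRadonMeasure Λ}
    {P : Measure (DiffuseRadonMeasure Λ)} [IsProbabilityMeasure P]
    {p : DiffuseRadonMeasure Λ → Λ → ℝ} (hp : Measurable (Function.uncurry p))
    (hp_int : Integrable
      (fun y : (ConfigSpace Λ × DiffuseRadonMeasure Λ) × Λ => p y.1.2 y.2 - 1)
      ((independentLaw σ P).prod σ.toMeasure)) :
    ENNReal.ofReal (∫ z, (∫ x, |p z.2 x - 1| ∂σ.toMeasure) ∂(independentLaw σ P))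
      = ∫⁻ m, ∫⁻ x, ENNReal.ofReal |p m x - 1| ∂σ.toMeasure ∂P := by
  have : SecondCountableTopology Λ := EMetric.secondCountable_of_sigmaCompact Λ
  have := σ.locallyFinite
  have := isProbabilityMeasure_poissonLaw σ
  have : IsProbabilityMeasure (independentLaw σ P) := by unfold independentLaw; infer_instance
  have hm : Measurable fun y : DiffuseRadonMeasure Λ × Λ => ENNReal.ofReal |p y.1 y.2 - 1| :=
    ((hp.sub measurable_const).abs).ennreal_ofReal
  have h1 := integral_prod _ hp_int.abs
  rw [← h1, ofReal_integral_eq_lintegral_ofReal hp_int.abs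
    (Eventually.of_forall fun _ => abs_nonneg _), lintegral_prod
      (fun y : (ConfigSpace Λ × DiffuseRadonMeasure Λ) × Λ => ENNReal.ofReal |p y.1.2 y.2 - 1|)
      (Measurable.aemeasurable (hm.comp
        (f := fun y : (ConfigSpace Λ × DiffuseRadonMeasure Λ) × Λ => (y.1.2, y.2))
        ((measurable_snd.comp measurable_fst).prodMk measurable_snd)))]
  exact (measurePreserving_snd (μ := poissonLaw σ) (ν := P)).lintegral_comp
    (f := fun m => ∫⁻ x, ENNReal.ofReal |p m x - 1| ∂σ.toMeasure) hm.lintegral_prod_right'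

end Main

theorem mainTheorem7 {Λ : Type*} [MetricSpace Λ] [SigmaCompactSpace Λ] [LocallyCompactSpace Λ]
    [MeasurableSpace Λ] [BorelSpace Λ]
    (σ : DiffuseRadonMeasure Λ)
    (P : Measure (DiffuseRadonMeasure Λ)) [IsProbabilityMeasure P]
    -- almost surely, the random intensity is absolutely continuous with respect to `σ`
    (hac : ∀ᵐ z ∂(independentLaw σ P), z.2.toMeasure ≪ σ.toMeasure)
    -- `p` is a measurable version of the density of the random intensity
    (p : DiffuseRadonMeasure Λ → Λ → ℝ)
    (hp_meas : Measurable (Function.uncurry p))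
    (hp : ∀ᵐ z ∂(independentLaw σ P),
      p z.2 =ᵐ[σ.toMeasure] fun x => (z.2.toMeasure.rnDeriv σ.toMeasure x).toReal)
    (hp_int : Integrable
      (fun y : (ConfigSpace Λ × DiffuseRadonMeasure Λ) × Λ => p y.1.2 y.2 - 1)
      ((independentLaw σ P).prod σ.toMeasure)) :
    rubinsteinDist
        (fun z w : ConfigSpace Λ × DiffuseRadonMeasure Λ => totalVariationDist z.1 w.1)
        (independentLaw σ P) (coxLaw P)
      ≤ ENNReal.ofReal
          (∫ z, (∫ x, |p z.2 x - 1| ∂σ.toMeasure) ∂(independentLaw σ P)) := by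
  have : SecondCountableTopology Λ := EMetric.secondCountable_of_sigmaCompact Λ
  rcases isEmpty_or_nonempty Λ with hΛ | hΛ
  · exact (rubinsteinDist_le_of_isEmpty σ P).trans zero_le
  rw [lintegral_eq_ofReal_integral hp_meas hp_int]
  refine rubinsteinDist_le_lintegral σ P hp_meas ?_
  filter_upwards [ae_of_ae_independentLaw (r := fun m => m.toMeasure ≪ σ.toMeasure) hac,
    ae_of_ae_independentLaw (r := fun m => p m =ᵐ[σ.toMeasure]
      fun x => (m.toMeasure.rnDeriv σ.toMeasure x).toReal) hp] with m hm hpm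
  have := m.locallyFinite
  have := σ.locallyFinite
  -- Absolute continuity makes `m` equal to its Radon–Nikodym part; passing to real values loses
  -- nothing because the derivative is finite almost everywhere.
  rw [← Measure.withDensity_rnDeriv_eq _ _ hm]
  refine withDensity_congr_ae ?_
  filter_upwards [hpm, Measure.rnDeriv_lt_top m.toMeasure σ.toMeasure] with x hx hx'
  rw [hx, ENNReal.ofReal_toReal hx'.ne]
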